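/- Let $m,n\ge 1$, let $\mathbb X$ be a set of data sets with an adjacency relation $X\simeq X'$, let $\varepsilon>0$ and $\delta\in(0,1)$. A mechanism $K$ is $(\varepsilon,\delta)$-DP if $\Pr(K(X)\in O)\le e^{\varepsilon}\Pr(K(X')\in O)+\delta$ for all $X\simeq X'$ and all measurable $O$. For $f:\mathbb X\to\mathbb R^{m\times n}$ let $s_2(f)=\sup_{X\simeq X'}\|f(X)-f(X')\|_F$, assumed finite. For positive definite $\Sigma_1\in\mathbb R^{m\times m}$ and $\Sigma_2\in\mathbb R^{n\times n}$ let $\mathcal{MN}(0,\Sigma_1,\Sigma_2)$ be the matrix Gaussian distribution, with density $$\frac{\exp\{-\tfrac12\|U_1^{-1}ZU_2^{-\top}\|_F^2\}}{(2\pi)^{mn/2}|\Sigma_1|^{n/2}|\Sigma_2|^{m/2}},\qquad \Sigma_k=U_kU_k^{\top},$$ which does not depend on the choice of the square matrices $U_1,U_2$. Let $\sigma_{\min}(U)$ be the smallest singular value of $U$, let $\Phi$ be the standard normal distribution function, and for $x>0$ let $$g(x)=\Phi\Big(\frac x2-\frac{\varepsilon}{x}\Big)-e^{\varepsilon}\,\Phi\Big(-\frac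 x2-\frac{\varepsilon}{x}\Big).$$ The equation $g(x)=\delta$ has exactly one root $B>0$, and the following hold. 1. (Fixed query.) Let $f$ have sensitivity $s=s_2(f)<\infty$. If $\sigma_{\min}(U_1)\,\sigma_{\min}(U_2)\ge s/B$, then the mechanism $f(X)+Z$ with $Z\sim\mathcal{MN}(0,\Sigma_1,\Sigma_2)$, $\Sigma_k=U_kU_k^\top$, is $(\varepsilon,\delta)$-DP. Moreover, $f(X)+Z$ is $(\varepsilon,\delta)$-DP if the entries of $Z$ are i.i.d. Gaussian with mean $0$ and standard deviation $s/B$. If every matrix $\Delta$ with $\|\Delta\|_F=s$ is a limit of differences $f(X)-f(X')$ with $X\simeq X'$, then $$f(X)+Z,\ Z\sim\mathcal{MN}(0,\Sigma_1,\Sigma_2),\ \text{is }(\varepsilon,\delta)\text{-DP}\iff \sigma_{\min}(U_1)\,\sigma_{\min}(U_2)\ge \frac{s}{B}.$$ 2. (All queries of a given sensitivity.) Suppose that some two distinct data sets are adjacent, and let $0\le s<\infty$. Then, for $\Sigma_k=U_kU_k^\top$ as above, $f(X)+Z$ with $Z\sim\mathcal{MN}(0,\Sigma_1,\Sigma_2)$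 is $(\varepsilon,\delta)$-DP for every $f:\mathbb X\to\mathbb R^{m\times n}$ with $s_2(f)=s$ if and only if $\sigma_{\min}(U_1)\,\sigma_{\min}(U_2)\ge s/B$. 3. (Optimal noise.) Let $s>0$. Under the assumptions of the equivalence in 1 (respectively, of 2), let $\mathcal G$ be the set of all matrix Gaussian laws $\mathcal{MN}(0,\Sigma_1,\Sigma_2)$ for which the mechanism $f(X)+Z$ is $(\varepsilon,\delta)$-DP (respectively, is so for every $f$ with $s_2(f)=s$). The law of a matrix with i.i.d. Gaussian entries of mean $0$ and standard deviation $s/B$ belongs to $\mathcal G$, it has the least $\mathbb E\,Z_{ij}^2$ in $\mathcal G$ for each entry $(i,j)$, and it is the unique law in $\mathcal G$ with the least $\mathbb E\|Z\|_F^2$. -/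

import Mathlib

open MeasureTheory ProbabilityTheory
open scoped NNReal ENNReal Matrix Matrix.Norms.Frobenius

noncomputable section

namespace MatrixDP

/-- Real `m × n` matrices carry the Borel structure and the Lebesgue measure of `ℝ^(m × n)`
(the product over the entries).  The norm `‖·‖` on matrices is everywhere the Frobenius norm. -/
instance matrixMeasureSpace (m n : ℕ) : MeasureSpace (Matrix (Fin m) (Fin n) ℝ) :=
  inferInstanceAs (MeasureSpace (Fin m → Fin n → ℝ))

/-- `(ε, δ)`-differential privacy of the randomized mechanism `K`, given by the law `K X` of its
output on the data set `X`; `Adj X X'` says that `X` and `X'` differ in one record. -/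
def IsDP {𝕏 𝕐 : Type*} [MeasurableSpace 𝕐] (Adj : 𝕏 → 𝕏 → Prop) (ε δ : ℝ)
    (K : 𝕏 → Measure 𝕐) : Prop :=
  ∀ X X' : 𝕏, Adj X X' → ∀ O : Set 𝕐, MeasurableSet O →
    K X O ≤ ENNReal.ofReal (Real.exp ε) * K X' O + ENNReal.ofReal δ

/-- The `ℓ₂`-sensitivity of a matrix-valued query: the supremum of `‖f X - f X'‖_F` over adjacent
`X, X'` (it may be infinite). -/
def l2Sensitivity {m n : ℕ} {𝕏 : Type*} (Adj : 𝕏 → 𝕏 → Prop)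
    (f : 𝕏 → Matrix (Fin m) (Fin n) ℝ) : ℝ≥0∞ :=
  ⨆ (X : 𝕏) (X' : 𝕏) (_ : Adj X X'), ‖f X - f X'‖ₑ

/-- The density of the matrix Gaussian distribution with mean `M`, row covariance `S₁` and column
covariance `S₂` (positive definite).  The exponent is `-‖U₁⁻¹ (Z - M) U₂⁻ᵀ‖_F² / 2` for all `U₁, U₂`
with `U₁ U₁ᵀ = S₁` and `U₂ U₂ᵀ = S₂`, see `trace_eq_norm_sq`. -/
def matrixGaussianPDF {m n : ℕ} (M : Matrix (Fin m) (Fin n) ℝ) (S₁ : Matrix (Fin m) (Fin m) ℝ)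
    (S₂ : Matrix (Fin n) (Fin n) ℝ) (Z : Matrix (Fin m) (Fin n) ℝ) : ℝ :=
  Real.exp (-(1 / 2) * (S₂⁻¹ * (Z - M)ᵀ * S₁⁻¹ * (Z - M)).trace) /
    ((2 * Real.pi) ^ ((m : ℝ) * n / 2) * S₁.det ^ ((n : ℝ) / 2) * S₂.det ^ ((m : ℝ) / 2))

theorem trace_eq_norm_sq {m n : ℕ} (A : Matrix (Fin m) (Fin n) ℝ) (U₁ : Matrix (Fin m) (Fin m) ℝ)
    (U₂ : Matrix (Fin n) (Fin n) ℝ) :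
    ((U₂ * U₂ᵀ)⁻¹ * Aᵀ * (U₁ * U₁ᵀ)⁻¹ * A).trace = ‖U₁⁻¹ * A * (U₂⁻¹)ᵀ‖ ^ 2 := by
  have h : ∀ C : Matrix (Fin m) (Fin n) ℝ, ‖C‖ ^ 2 = (Cᵀ * C).trace := by
    intro C
    rw [Matrix.frobenius_norm_def, ← Real.sqrt_eq_rpow, Real.sq_sqrt (by positivity),
      Finset.sum_comm]
    simp [Matrix.trace, Matrix.mul_apply, pow_two]
  rw [h, Matrix.mul_inv_rev, Matrix.mul_inv_rev]
  simp only [Matrix.transpose_mul, Matrix.transpose_transpose, Matrix.transpose_nonsing_inv,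
    Matrix.mul_assoc]
  rw [Matrix.trace_mul_comm]
  simp only [Matrix.mul_assoc]

/-- The matrix Gaussian distribution `MN(M, S₁, S₂)`. -/
def matrixGaussian {m n : ℕ} (M : Matrix (Fin m) (Fin n) ℝ) (S₁ : Matrix (Fin m) (Fin m) ℝ)
    (S₂ : Matrix (Fin n) (Fin n) ℝ) : Measure (Matrix (Fin m) (Fin n) ℝ) :=
  volume.withDensity fun Z => ENNReal.ofReal (matrixGaussianPDF M S₁ S₂ Z)

/-- The law of an `m × n` matrix with independent entries, each Gaussian with mean `0` and
standard deviation `|c|`. -/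
def iidGaussian (m n : ℕ) (c : ℝ) : Measure (Matrix (Fin m) (Fin n) ℝ) :=
  (Measure.pi fun _ : Fin m => Measure.pi fun _ : Fin n => gaussianReal 0 (‖c‖₊ ^ 2)).map
    Matrix.of

/-- The additive noise mechanism `X ↦ f X + Z`, where `Z` has law `ν`. -/
def additiveMechanism {m n : ℕ} {𝕏 : Type*} (f : 𝕏 → Matrix (Fin m) (Fin n) ℝ)
    (ν : Measure (Matrix (Fin m) (Fin n) ℝ)) (X : 𝕏) : Measure (Matrix (Fin m) (Fin n) ℝ) :=
  ν.map fun Z => f X + Z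

/-- The standard normal distribution function `Φ`. -/
def stdNormalCDF (t : ℝ) : ℝ := cdf (gaussianReal 0 1) t

/-- `g(x) = Φ(x/2 - ε/x) - e^ε Φ(-x/2 - ε/x)`, for `x > 0`. -/
def privacyCurve (ε x : ℝ) : ℝ :=
  stdNormalCDF (x / 2 - ε / x) - Real.exp ε * stdNormalCDF (-x / 2 - ε / x)

/-- The smallest singular value `σ_k(U)` of a `k × k` matrix (`k ≥ 1`); Mathlib lists the singular
values in non-increasing order, starting from the index `0`. -/
def minSingularValue {k : ℕ} (U : Matrix (Fin k) (Fin k) ℝ) : ℝ :=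
  (Matrix.toEuclideanLin U).singularValues (k - 1)

/-- The noise law `ν` is optimal in the class `𝒢` of noise laws: it belongs to `𝒢`, in each single
entry it has the least second moment in `𝒢`, and it is the unique law in `𝒢` with the least
expected squared Frobenius norm. -/
structure IsOptimalNoise {m n : ℕ} (𝒢 : Set (Measure (Matrix (Fin m) (Fin n) ℝ)))
    (ν : Measure (Matrix (Fin m) (Fin n) ℝ)) : Prop where
  mem : ν ∈ 𝒢
  entry_le : ∀ μ ∈ 𝒢, ∀ i j, ∫⁻ Z, ‖Z i j‖ₑ ^ 2 ∂ν ≤ ∫⁻ Z, ‖Z i j‖ₑ ^ 2 ∂μ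
  energy_le : ∀ μ ∈ 𝒢, ∫⁻ Z, ‖Z‖ₑ ^ 2 ∂ν ≤ ∫⁻ Z, ‖Z‖ₑ ^ 2 ∂μ
  unique : ∀ μ ∈ 𝒢, ∫⁻ Z, ‖Z‖ₑ ^ 2 ∂μ = ∫⁻ Z, ‖Z‖ₑ ^ 2 ∂ν → μ = ν

end MatrixDP

end

/-!
# Optimal matrix Gaussian noise for differential privacy

If `Z` has independent standard normal entries, then `U₁ * Z * U₂ᵀ` has the law
`MN(0, U₁ * U₁ᵀ, U₂ * U₂ᵀ)` (`matrixGaussian_eq_gaussianOfFactors`; after vectorization this is the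
linear change of variables by `U₂ ⊗ₖ U₁`). Undoing the factors, the outputs on two data sets with
query values differing by `Δ` become a standard Gaussian law and its translate by
`D = U₁⁻¹ * Δ * U₂⁻ᵀ`. The likelihood ratio of the two is `exp (⟪D, w⟫ - ‖D‖ ^ 2 / 2)`, so by the
Neyman–Pearson inequality (`withDensity_add_const_mul_le`) the worst event is a half-space
orthogonal to `D`, and its excess probability is `privacyCurve ε ‖D‖`
(`forall_map_add_right_le_iff`). The derivative of the privacy curve is a normal density, hence the
curve increases strictly from `0` to `1`: it takes the value `δ` at exactly one `B`, and privacy of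
the pair means `‖D‖ ≤ B` (`forall_additiveMechanism_le_iff`).

The largest value of `‖U₁⁻¹ * Δ * U₂⁻ᵀ‖` over all `Δ` of norm at most `s` is `s / (σ₁ * σ₂)`, where
`σ₁`, `σ₂` are the smallest singular values; it is attained at a rank-one `Δ`
(`minSingularValue_mul_mul_norm_le`, `exists_norm_mul_mul_eq`). This gives the criterion
`s / B ≤ σ₁ * σ₂`, whose necessity needs only that differences close to the extremal `Δ` occur,
either by assumption or because the query may be chosen.

For optimality, the second moment of the entry `(i, j)` of `MN(0, S₁, S₂)` is `S₁ i i * S₂ j j`. The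
diagonal entries of a covariance are at least its smallest eigenvalue, so this is at least
`(σ₁ * σ₂) ^ 2 ≥ (s / B) ^ 2`. If the energy is minimal, all these inequalities are equalities, which
forces both covariances to be scalar (`eq_smul_one_of_diag_eq`).
-/

namespace MatrixDP

/-! ### The privacy curve -/

theorem hasDerivAt_stdNormalCDF (t : ℝ) :
    HasDerivAt stdNormalCDF (gaussianPDFReal 0 1 t) t := by
  have hint := integrable_gaussianPDFReal 0 1
  have hcont : Continuous (gaussianPDFReal 0 1) := by
    unfold gaussianPDFReal; fun_prop
  have heq : stdNormalCDF = fun u =>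
      (∫ x in Set.Iic (0 : ℝ), gaussianPDFReal 0 1 x) + ∫ x in (0 : ℝ)..u, gaussianPDFReal 0 1 x := by
    funext u
    rw [stdNormalCDF, cdf_eq_real, Measure.real, gaussianReal_apply_eq_integral 0 one_ne_zero,
      ENNReal.toReal_ofReal (integral_nonneg fun x => gaussianPDFReal_nonneg _ _ _),
      ← intervalIntegral.integral_Iic_sub_Iic hint.integrableOn hint.integrableOn]
    ring
  rw [heq]
  exact (intervalIntegral.integral_hasDerivAt_right (hint.intervalIntegrable)
    hcont.aestronglyMeasurable.stronglyMeasurableAtFilter hcont.continuousAt).const_add _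

/-- The derivative of the privacy curve is the normal density at `x / 2 - ε / x`: the factor `e^ε`
turns the density at `-x / 2 - ε / x` into the density at `x / 2 - ε / x`, so that the two inner
derivatives add up to `1`. -/
theorem hasDerivAt_privacyCurve (ε : ℝ) {x : ℝ} (hx : 0 < x) :
    HasDerivAt (privacyCurve ε) (gaussianPDFReal 0 1 (x / 2 - ε / x)) x := by
  have hx0 : x ≠ 0 := hx.ne'
  have hinv : HasDerivAt (fun y : ℝ => ε / y) (-(ε / x ^ 2)) x := by
    convert! (hasDerivAt_inv hx0).const_mul ε using 1
    ring
  have h1 := ((hasDerivAt_id x).div_const 2).sub hinv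
  have h2 := ((hasDerivAt_id x).neg.div_const 2).sub hinv
  have hpdf : Real.exp ε * gaussianPDFReal 0 1 (-x / 2 - ε / x)
      = gaussianPDFReal 0 1 (x / 2 - ε / x) := by
    simp only [gaussianPDFReal]
    rw [mul_left_comm, ← Real.exp_add]
    congr 2
    simp
    field_simp
    ring
  have h := ((hasDerivAt_stdNormalCDF (x / 2 - ε / x)).comp x h1).sub
    (((hasDerivAt_stdNormalCDF (-x / 2 - ε / x)).comp x h2).const_mul (Real.exp ε))
  convert! h using 1
  rw [← mul_assoc, hpdf]
  ring

theorem strictMonoOn_privacyCurve (ε : ℝ) : StrictMonoOn (privacyCurve ε) (Set.Ioi 0) := by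
  refine strictMonoOn_of_deriv_pos (convex_Ioi 0)
    (fun x hx => (hasDerivAt_privacyCurve ε hx).continuousAt.continuousWithinAt) fun x hx => ?_
  rw [interior_Ioi] at hx
  rw [(hasDerivAt_privacyCurve ε hx).deriv]
  exact gaussianPDFReal_pos _ _ _ one_ne_zero

open Filter Topology in
theorem tendsto_privacyCurve_nhdsGT_zero {ε : ℝ} (hε : 0 < ε) :
    Tendsto (privacyCurve ε) (𝓝[>] 0) (𝓝 0) := by
  have hdiv : Tendsto (fun x : ℝ => -(ε / x)) (𝓝[>] 0) atBot := by
    simp only [div_eq_mul_inv]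
    exact tendsto_neg_atTop_atBot.comp (tendsto_inv_nhdsGT_zero.const_mul_atTop hε)
  have hid : ∀ c : ℝ, Tendsto (fun x : ℝ => x * c) (𝓝[>] 0) (𝓝 (0 * c)) := fun c =>
    (tendsto_nhdsWithin_of_tendsto_nhds tendsto_id).mul_const c
  have h1 := (tendsto_cdf_atBot (gaussianReal 0 1)).comp ((hid 2⁻¹).add_atBot hdiv)
  have h2 := (tendsto_cdf_atBot (gaussianReal 0 1)).comp ((hid (-2⁻¹)).add_atBot hdiv)
  have h := h1.sub (h2.const_mul (Real.exp ε))
  rw [mul_zero, sub_zero] at h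
  refine h.congr fun x => ?_
  simp only [privacyCurve, stdNormalCDF, Function.comp]
  congr 3
  ring

open Filter Topology in
theorem tendsto_privacyCurve_atTop (ε : ℝ) : Tendsto (privacyCurve ε) atTop (𝓝 1) := by
  have hdiv : Tendsto (fun x : ℝ => -(ε / x)) atTop (𝓝 (-0)) :=
    (tendsto_const_nhds.div_atTop tendsto_id).neg
  have h1 := (tendsto_cdf_atTop (gaussianReal 0 1)).comp
    ((tendsto_id.atTop_mul_const (show (0 : ℝ) < 2⁻¹ by norm_num)).atTop_add hdiv)
  have h2 := (tendsto_cdf_atBot (gaussianReal 0 1)).comp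
    ((tendsto_id.atTop_mul_const_of_neg (show -(2 : ℝ)⁻¹ < 0 by norm_num)).atBot_add hdiv)
  have h := h1.sub (h2.const_mul (Real.exp ε))
  rw [mul_zero, sub_zero] at h
  refine h.congr fun x => ?_
  simp only [privacyCurve, stdNormalCDF, Function.comp, id]
  congr 3
  ring

theorem existsUnique_privacyCurve_eq {ε δ : ℝ} (hε : 0 < ε) (hδ₀ : 0 < δ) (hδ₁ : δ < 1) :
    ∃! B : ℝ, 0 < B ∧ privacyCurve ε B = δ := by
  have hcont : ContinuousOn (privacyCurve ε) (Set.Ioi 0) := fun x hx =>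
    (hasDerivAt_privacyCurve ε hx).continuousAt.continuousWithinAt
  obtain ⟨B, hB, hBδ⟩ := isPreconnected_Ioi.intermediate_value_Ioo
    (Filter.le_principal_iff.2 self_mem_nhdsWithin)
    (Filter.le_principal_iff.2 (Filter.Ioi_mem_atTop 0)) hcont
    (tendsto_privacyCurve_nhdsGT_zero hε) (tendsto_privacyCurve_atTop ε) ⟨hδ₀, hδ₁⟩
  refine ⟨B, ⟨hB, hBδ⟩, fun C hC => ?_⟩
  exact (strictMonoOn_privacyCurve ε).injOn hC.1 hB (hC.2.trans hBδ.symm)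

/-! ### The standard Gaussian law on `ι → ℝ` -/

section StdGaussian

variable {ι : Type*} [Fintype ι]

variable (ι) in
/-- The law of a vector of independent standard normal variables indexed by `ι`. -/
noncomputable abbrev stdGaussianPi : Measure (ι → ℝ) := Measure.pi fun _ : ι => gaussianReal 0 1

/-- The Lebesgue density of `stdGaussianPi ι`. -/
noncomputable def stdGaussianPiPDF (w : ι → ℝ) : ℝ :=
  (√(2 * Real.pi))⁻¹ ^ Fintype.card ι * Real.exp (-(w ⬝ᵥ w) / 2)

theorem stdGaussianPiPDF_eq_prod (w : ι → ℝ) :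
    stdGaussianPiPDF w = ∏ i, gaussianPDFReal 0 1 (w i) := by
  simp only [gaussianPDFReal, stdGaussianPiPDF, Finset.prod_mul_distrib, Finset.prod_const,
    Finset.card_univ, ← Real.exp_sum, dotProduct, NNReal.coe_one, mul_one, sub_zero]
  congr 2
  rw [← Finset.sum_neg_distrib, Finset.sum_div]
  exact Finset.sum_congr rfl fun i _ => by ring

theorem stdGaussianPiPDF_nonneg (w : ι → ℝ) : 0 ≤ stdGaussianPiPDF w := by
  unfold stdGaussianPiPDF; positivity

theorem measurable_stdGaussianPiPDF : Measurable (stdGaussianPiPDF (ι := ι)) := by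
  unfold stdGaussianPiPDF dotProduct; fun_prop

theorem stdGaussianPi_eq_withDensity :
    stdGaussianPi ι = volume.withDensity fun w => ENNReal.ofReal (stdGaussianPiPDF w) := by
  refine Measure.pi_eq fun s hs => ?_
  rw [withDensity_apply _ (MeasurableSet.univ_pi hs), volume_pi, Measure.restrict_pi_pi]
  simp only [stdGaussianPiPDF_eq_prod]
  rw [← ofReal_integral_eq_lintegral_ofReal, integral_fintype_prod_eq_prod,
    ENNReal.ofReal_prod_of_nonneg]
  · exact Finset.prod_congr rfl fun i _ =>
      (gaussianReal_apply_eq_integral 0 one_ne_zero (s i)).symm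
  · exact fun i _ => integral_nonneg fun x => gaussianPDFReal_nonneg _ _ _
  · exact Integrable.fintype_prod fun i => (integrable_gaussianPDFReal 0 1).restrict
  · exact ae_of_all _ fun w => Finset.prod_nonneg fun i _ => gaussianPDFReal_nonneg _ _ _

theorem map_withDensity_equiv {α β : Type*} [MeasurableSpace α] [MeasurableSpace β]
    (μ : Measure α) (e : α ≃ᵐ β) {p : α → ℝ≥0∞} :
    (μ.withDensity p).map e = (μ.map e).withDensity (p ∘ e.symm) := by
  ext s hs
  rw [e.map_apply, withDensity_apply _ (e.measurable hs), withDensity_apply _ hs,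
    e.restrict_map, lintegral_map_equiv]
  simp

/-- The law of a linear form under the standard Gaussian law. -/
theorem map_dotProduct_stdGaussianPi (d : ι → ℝ) :
    (stdGaussianPi ι).map (fun w => d ⬝ᵥ w) = gaussianReal 0 (d ⬝ᵥ d).toNNReal := by
  have hd : 0 ≤ d ⬝ᵥ d := Finset.sum_nonneg fun i _ => mul_self_nonneg _
  have hmeas : Measurable fun w : ι → ℝ => d ⬝ᵥ w := by unfold dotProduct; fun_prop
  have : IsProbabilityMeasure ((stdGaussianPi ι).map (fun w => d ⬝ᵥ w)) :=
    Measure.isProbabilityMeasure_map hmeas.aemeasurable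
  refine Measure.ext_of_charFun (funext fun t => ?_)
  have h := charFun_stdGaussian (E := EuclideanSpace ℝ ι) (WithLp.toLp 2 (t • d))
  rw [← map_pi_eq_stdGaussian, charFun_apply, integral_map (by fun_prop) (by fun_prop)] at h
  rw [charFun_apply_real, integral_map hmeas.aemeasurable (by fun_prop), charFun_gaussianReal]
  convert! h using 2
  · funext w
    simp [EuclideanSpace.inner_eq_star_dotProduct, smul_dotProduct]
  · rw [← Complex.ofReal_pow ‖_‖, EuclideanSpace.real_norm_sq_eq, Real.coe_toNNReal _ hd]
    simp only [dotProduct, Pi.smul_apply, smul_eq_mul, mul_pow,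
      ← Finset.mul_sum]
    push_cast
    simp only [pow_two]
    ring

/-- Translating the standard Gaussian law multiplies it by an exponential density. -/
theorem map_add_right_stdGaussianPi (d : ι → ℝ) :
    (stdGaussianPi ι).map (· + d) = (stdGaussianPi ι).withDensity fun w =>
      ENNReal.ofReal (Real.exp (d ⬝ᵥ w - d ⬝ᵥ d / 2)) := by
  have hmeas : Measurable fun w : ι → ℝ => Real.exp (d ⬝ᵥ w - d ⬝ᵥ d / 2) := by
    unfold dotProduct; fun_prop
  rw [stdGaussianPi_eq_withDensity, ← withDensity_mul _ (by
    exact measurable_stdGaussianPiPDF.ennreal_ofReal) hmeas.ennreal_ofReal]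
  have h := map_withDensity_equiv (volume : Measure (ι → ℝ)) (MeasurableEquiv.addRight d)
    (p := fun w => ENNReal.ofReal (stdGaussianPiPDF w))
  rw [MeasurableEquiv.coe_addRight, map_add_right_eq_self (volume : Measure (ι → ℝ)) d] at h
  rw [h]
  congr 1
  funext w
  simp only [Function.comp, Pi.mul_apply, MeasurableEquiv.symm_addRight,
    MeasurableEquiv.coe_addRight]
  rw [← ENNReal.ofReal_mul (stdGaussianPiPDF_nonneg _), stdGaussianPiPDF, stdGaussianPiPDF,
    mul_assoc, ← Real.exp_add]
  congr 3
  simp only [add_dotProduct, dotProduct_add, neg_dotProduct, dotProduct_neg, dotProduct_comm w d]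
  ring

/-- The standard Gaussian law of a closed half-space. -/
theorem stdGaussianPi_halfSpace (d : ι → ℝ) {r : ℝ} (hr : 0 < r) (hd : d ⬝ᵥ d = r ^ 2) (t : ℝ) :
    stdGaussianPi ι {w | t ≤ d ⬝ᵥ w} = ENNReal.ofReal (stdNormalCDF (-t / r)) := by
  have hmeas : Measurable fun w : ι → ℝ => (-r⁻¹) * (d ⬝ᵥ w) := by unfold dotProduct; fun_prop
  have hlaw : (stdGaussianPi ι).map (fun w => (-r⁻¹) * (d ⬝ᵥ w)) = gaussianReal 0 1 := by
    have h := map_dotProduct_stdGaussianPi ((-r⁻¹) • d)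
    simp only [smul_dotProduct, smul_eq_mul, dotProduct_smul, hd] at h
    rw [h, show (-r⁻¹) * ((-r⁻¹) * r ^ 2) = 1 by field_simp, Real.toNNReal_one]
  rw [stdNormalCDF, ofReal_cdf, ← hlaw, Measure.map_apply hmeas measurableSet_Iic]
  congr 1
  ext w
  simp only [Set.mem_ofPred_eq, Set.mem_preimage, Set.mem_Iic, neg_mul, neg_div, neg_le_neg_iff]
  rw [inv_mul_eq_div, div_le_div_iff_of_pos_right hr]

/-- The Neyman–Pearson inequality: if the set `A` separates the points where the density `p` is
above the level `c` from those where it is below, then no set `O` gives a larger value of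
`(μ.withDensity p) O - c * μ O` than `A`. -/
theorem withDensity_add_const_mul_le {α : Type*} [MeasurableSpace α] {μ : Measure α}
    {p : α → ℝ≥0∞} {c : ℝ≥0∞} {A O : Set α} (hA : MeasurableSet A)
    (hO : MeasurableSet O) (h₁ : ∀ x ∈ A, c ≤ p x) (h₂ : ∀ x ∉ A, p x ≤ c) :
    μ.withDensity p O + c * μ A ≤ μ.withDensity p A + c * μ O := by
  have hup : μ.withDensity p (O \ A) ≤ c * μ (O \ A) := by
    rw [withDensity_apply _ (hO.diff hA), ← setLIntegral_const]
    exact setLIntegral_mono measurable_const fun x hx => h₂ x hx.2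
  have hdown : c * μ (A \ O) ≤ μ.withDensity p (A \ O) := by
    rw [withDensity_apply _ (hA.diff hO), ← setLIntegral_const]
    exact setLIntegral_mono' (hA.diff hO) fun x hx => h₁ x hx.1
  rw [← measure_inter_add_sdiff (μ := μ.withDensity p) O hA,
    ← measure_inter_add_sdiff (μ := μ) A hO, ← measure_inter_add_sdiff (μ := μ.withDensity p) A hO,
    ← measure_inter_add_sdiff (μ := μ) O hA, Set.inter_comm A O, mul_add, mul_add]
  calc _ = μ.withDensity p (O ∩ A) + c * μ (O ∩ A)
        + (μ.withDensity p (O \ A) + c * μ (A \ O)) := by ring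
    _ ≤ μ.withDensity p (O ∩ A) + c * μ (O ∩ A)
        + (c * μ (O \ A) + μ.withDensity p (A \ O)) := by gcongr
    _ = _ := by ring

/-- The `(ε, δ)`-comparison of a translated standard Gaussian law with the standard one is decided
by the half-space where the likelihood ratio is at least `e^ε`. -/
theorem forall_map_add_right_le_iff (d : ι → ℝ) {r ε δ : ℝ} (hr : 0 < r) (hd : d ⬝ᵥ d = r ^ 2)
    (hδ : 0 ≤ δ) :
    (∀ O : Set (ι → ℝ), MeasurableSet O → (stdGaussianPi ι).map (· + d) O ≤
      ENNReal.ofReal (Real.exp ε) * stdGaussianPi ι O + ENNReal.ofReal δ) ↔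
    privacyCurve ε r ≤ δ := by
  have hmeas : Measurable fun w : ι → ℝ => d ⬝ᵥ w := by unfold dotProduct; fun_prop
  set A : Set (ι → ℝ) := {w | ε + r ^ 2 / 2 ≤ d ⬝ᵥ w} with hAdef
  have hA : MeasurableSet A := measurableSet_le measurable_const hmeas
  have hQ : stdGaussianPi ι A = ENNReal.ofReal (stdNormalCDF (-r / 2 - ε / r)) := by
    rw [stdGaussianPi_halfSpace d hr hd]
    congr 2
    field_simp
    ring
  have hP : (stdGaussianPi ι).map (· + d) A = ENNReal.ofReal (stdNormalCDF (r / 2 - ε / r)) := by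
    rw [Measure.map_apply (measurable_add_const d) hA]
    -- translating by `d` moves the threshold by `d ⬝ᵥ d = r ^ 2`
    have : (· + d) ⁻¹' A = {w | ε - r ^ 2 / 2 ≤ d ⬝ᵥ w} := by
      ext w
      simp only [hAdef, Set.mem_preimage, Set.mem_ofPred_eq, dotProduct_add, hd]
      constructor <;> intro h <;> linarith
    rw [this, stdGaussianPi_halfSpace d hr hd]
    congr 2
    field_simp
    ring
  have hΦ : ∀ t, 0 ≤ stdNormalCDF t := fun t => cdf_nonneg _ t
  have hAiff : (stdGaussianPi ι).map (· + d) A ≤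
      ENNReal.ofReal (Real.exp ε) * stdGaussianPi ι A + ENNReal.ofReal δ ↔
      privacyCurve ε r ≤ δ := by
    rw [hP, hQ, ← ENNReal.ofReal_mul (Real.exp_nonneg _),
      ← ENNReal.ofReal_add (mul_nonneg (Real.exp_nonneg _) (hΦ _)) hδ,
      ENNReal.ofReal_le_ofReal_iff
        (add_nonneg (mul_nonneg (Real.exp_nonneg _) (hΦ _)) hδ), privacyCurve, sub_le_iff_le_add']
  rw [← hAiff]
  refine ⟨fun h => h A hA, fun h O hO => ?_⟩
  have hNP := withDensity_add_const_mul_le (μ := stdGaussianPi ι)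
    (p := fun w => ENNReal.ofReal (Real.exp (d ⬝ᵥ w - d ⬝ᵥ d / 2)))
    (c := ENNReal.ofReal (Real.exp ε)) hA hO
    (fun w hw => ENNReal.ofReal_le_ofReal (Real.exp_le_exp.2 (by
      rw [hd]; have : ε + r ^ 2 / 2 ≤ d ⬝ᵥ w := hw
      linarith)))
    (fun w hw => ENNReal.ofReal_le_ofReal (Real.exp_le_exp.2 (by
      rw [hd]; have : d ⬝ᵥ w < ε + r ^ 2 / 2 := not_le.1 hw
      linarith)))
  rw [← map_add_right_stdGaussianPi] at hNP
  have hfin : ENNReal.ofReal (Real.exp ε) * stdGaussianPi ι A ≠ ∞ :=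
    ENNReal.mul_ne_top ENNReal.ofReal_ne_top (measure_ne_top _ _)
  -- the optimal event `A` has excess probability at most `δ`, hence so has `O`
  refine (ENNReal.add_le_add_iff_right hfin).1 (hNP.trans ?_)
  calc _ ≤ ENNReal.ofReal (Real.exp ε) * stdGaussianPi ι A + ENNReal.ofReal δ
        + ENNReal.ofReal (Real.exp ε) * stdGaussianPi ι O := by gcongr
    _ = _ := by ring

end StdGaussian

/-! ### Matrix Gaussian laws as images of the standard Gaussian law -/

section Vec

open scoped Kronecker

variable {m n : ℕ}

/-- Column-by-column vectorization `Matrix.vec` as a measurable equivalence. -/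
def vecEquiv (m n : ℕ) : Matrix (Fin m) (Fin n) ℝ ≃ᵐ (Fin n × Fin m → ℝ) where
  toFun := Matrix.vec
  invFun w := Matrix.of fun i j => w (j, i)
  left_inv _ := rfl
  right_inv _ := rfl
  measurable_toFun := measurable_pi_lambda _ fun p =>
    (measurable_pi_apply p.1).comp (measurable_pi_apply p.2)
  measurable_invFun := measurable_pi_lambda _ fun _ => measurable_pi_lambda _ fun _ =>
    measurable_pi_apply _

theorem coe_vecEquiv : ⇑(vecEquiv m n) = Matrix.vec := rfl

theorem vecEquiv_symm_apply (w : Fin n × Fin m → ℝ) (i : Fin m) (j : Fin n) :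
    (vecEquiv m n).symm w i j = w (j, i) := rfl

theorem map_uncurry_swap_pi_pi (μ : Measure ℝ) [SigmaFinite μ] :
    (Measure.pi fun _ : Fin m => Measure.pi fun _ : Fin n => μ).map
      (fun Z (p : Fin n × Fin m) => Z p.2 p.1) = Measure.pi fun _ => μ := by
  refine (Measure.pi_eq fun s hs => ?_).symm
  have hpre : (fun (Z : Fin m → Fin n → ℝ) (p : Fin n × Fin m) => Z p.2 p.1) ⁻¹' Set.univ.pi s =
      Set.univ.pi fun i : Fin m => Set.univ.pi fun j : Fin n => s (j, i) := by
    ext Z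
    simp only [Set.mem_preimage, Set.mem_univ_pi, Prod.forall]
    exact forall_comm
  rw [Measure.map_apply (by fun_prop) (MeasurableSet.univ_pi hs), hpre, Measure.pi_pi]
  simp only [Measure.pi_pi]
  rw [Fintype.prod_prod_type, Finset.prod_comm]

theorem map_vecEquiv_volume :
    (volume : Measure (Matrix (Fin m) (Fin n) ℝ)).map (vecEquiv m n) = volume :=
  map_uncurry_swap_pi_pi volume

theorem map_vecEquiv_iidGaussian (c : ℝ) :
    (iidGaussian m n c).map (vecEquiv m n) = Measure.pi fun _ => gaussianReal 0 (‖c‖₊ ^ 2) := by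
  have hof : Measurable (Matrix.of : (Fin m → Fin n → ℝ) → Matrix (Fin m) (Fin n) ℝ) :=
    measurable_id
  rw [iidGaussian, Measure.map_map (vecEquiv m n).measurable hof]
  exact map_uncurry_swap_pi_pi _

theorem norm_sq_eq_vec (Z : Matrix (Fin m) (Fin n) ℝ) : ‖Z‖ ^ 2 = Z.vec ⬝ᵥ Z.vec := by
  rw [Matrix.vec_dotProduct_vec, Matrix.frobenius_norm_def, ← Real.sqrt_eq_rpow,
    Real.sq_sqrt (by positivity), Finset.sum_comm]
  simp [Matrix.trace, Matrix.mul_apply, pow_two]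

theorem measurable_mulVec {ι κ : Type*} [Fintype ι] (A : Matrix κ ι ℝ) :
    Measurable (A *ᵥ · : (ι → ℝ) → κ → ℝ) := by
  unfold Matrix.mulVec dotProduct; fun_prop

/-- Multiplication of vectors by an invertible matrix as a measurable equivalence. -/
noncomputable def mulVecEquiv {ι : Type*} [Fintype ι] [DecidableEq ι] (A : Matrix ι ι ℝ)
    (hA : A.det ≠ 0) : (ι → ℝ) ≃ᵐ (ι → ℝ) where
  toFun := (A *ᵥ ·)
  invFun := (A⁻¹ *ᵥ ·)
  left_inv w := by simp [Matrix.nonsing_inv_mul _ hA.isUnit]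
  right_inv w := by simp [Matrix.mul_nonsing_inv _ hA.isUnit]
  measurable_toFun := measurable_mulVec A
  measurable_invFun := measurable_mulVec A⁻¹

/-- An invertible linear map turns the standard Gaussian law into a law with an explicit density. -/
theorem map_mulVec_stdGaussianPi {ι : Type*} [Fintype ι] [DecidableEq ι] {A : Matrix ι ι ℝ}
    (hA : A.det ≠ 0) :
    (stdGaussianPi ι).map (A *ᵥ ·) = volume.withDensity fun w =>
      ENNReal.ofReal (|A.det|⁻¹ * stdGaussianPiPDF (A⁻¹ *ᵥ w)) := by
  let e := mulVecEquiv A hA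
  have hvol : (volume : Measure (ι → ℝ)).map e = ENNReal.ofReal |A.det|⁻¹ • volume := by
    rw [← abs_inv]
    exact Real.map_matrix_volume_pi_eq_smul_volume_pi hA
  have h := map_withDensity_equiv (volume : Measure (ι → ℝ)) e
    (p := fun w => ENNReal.ofReal (stdGaussianPiPDF w))
  rw [← stdGaussianPi_eq_withDensity, hvol, withDensity_smul_measure,
    ← withDensity_smul _ (by
      exact (measurable_stdGaussianPiPDF.ennreal_ofReal).comp e.symm.measurable)] at h
  refine h.trans (congrArg _ (funext fun w => ?_))
  simp only [Pi.smul_apply, Function.comp, smul_eq_mul]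
  rw [← ENNReal.ofReal_mul (by positivity)]
  rfl

theorem det_kronecker_eq (U₁ : Matrix (Fin m) (Fin m) ℝ) (U₂ : Matrix (Fin n) (Fin n) ℝ) :
    (U₂ ⊗ₖ U₁).det = U₂.det ^ m * U₁.det ^ n := by
  rw [Matrix.det_kronecker, Fintype.card_fin, Fintype.card_fin]

theorem det_kronecker_ne_zero {U₁ : Matrix (Fin m) (Fin m) ℝ} {U₂ : Matrix (Fin n) (Fin n) ℝ}
    (h₁ : U₁.det ≠ 0) (h₂ : U₂.det ≠ 0) : (U₂ ⊗ₖ U₁).det ≠ 0 := by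
  rw [det_kronecker_eq]
  exact mul_ne_zero (pow_ne_zero _ h₂) (pow_ne_zero _ h₁)

/-- The law of `U₁ * Z * U₂ᵀ` where the entries of `Z` are independent standard normal variables,
written with the Kronecker product acting on the vectorization of `Z`. -/
noncomputable def gaussianOfFactors (U₁ : Matrix (Fin m) (Fin m) ℝ)
    (U₂ : Matrix (Fin n) (Fin n) ℝ) : Measure (Matrix (Fin m) (Fin n) ℝ) :=
  (stdGaussianPi (Fin n × Fin m)).map fun w => (vecEquiv m n).symm ((U₂ ⊗ₖ U₁) *ᵥ w)

theorem matrixGaussian_eq_gaussianOfFactors {U₁ : Matrix (Fin m) (Fin m) ℝ} {U₂ : Matrix (Fin n) (Fin n) ℝ}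
    (h₁ : U₁.det ≠ 0) (h₂ : U₂.det ≠ 0) :
    matrixGaussian 0 (U₁ * U₁ᵀ) (U₂ * U₂ᵀ) = gaussianOfFactors U₁ U₂ := by
  have hdet := det_kronecker_eq U₁ U₂
  have hdet0 := det_kronecker_ne_zero h₁ h₂
  have hsplit := Measure.map_map (μ := stdGaussianPi (Fin n × Fin m))
    (vecEquiv m n).symm.measurable (measurable_mulVec (U₂ ⊗ₖ U₁))
  refine Eq.trans ?_ hsplit
  rw [map_mulVec_stdGaussianPi hdet0, map_withDensity_equiv, ← map_vecEquiv_volume (m := m),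
    MeasurableEquiv.map_symm_map, matrixGaussian]
  refine congrArg _ (funext fun Z => congrArg _ ?_)
  simp only [MeasurableEquiv.symm_symm, coe_vecEquiv]
  rw [matrixGaussianPDF, sub_zero, trace_eq_norm_sq, norm_sq_eq_vec, stdGaussianPiPDF,
    Matrix.inv_kronecker, Matrix.kronecker_mulVec_vec, hdet]
  -- the normalizing constants: `(det U ^ 2) ^ (k / 2) = |det U| ^ k`
  have hpow : ∀ (x : ℝ) (k : ℕ), (x * x) ^ ((k : ℝ) / 2) = |x| ^ k := fun x k => by
    rw [← abs_mul_abs_self, ← pow_two, ← Real.rpow_natCast, ← Real.rpow_mul (abs_nonneg x),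
      Nat.cast_ofNat, mul_div_cancel₀ _ two_ne_zero, Real.rpow_natCast]
  have hpi : (2 * Real.pi) ^ ((m : ℝ) * n / 2) = √(2 * Real.pi) ^ (n * m) := by
    rw [Real.sqrt_eq_rpow, ← Real.rpow_natCast, ← Real.rpow_mul (by positivity)]
    push_cast
    congr 1
    ring
  rw [Matrix.det_mul, Matrix.det_mul, Matrix.det_transpose, Matrix.det_transpose, hpow, hpow, hpi,
    Fintype.card_prod, Fintype.card_fin, Fintype.card_fin, abs_mul, abs_pow, abs_pow, inv_pow,
    div_eq_mul_inv, mul_inv, mul_inv, mul_inv]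
  rw [show ∀ x : ℝ, -(1 / 2) * x = -x / 2 from fun x => by ring]
  ring

theorem iidGaussian_mul_eq_gaussianOfFactors (a b : ℝ) :
    iidGaussian m n (a * b) = gaussianOfFactors (a • 1) (b • 1) := by
  have hlaw : gaussianReal 0 (‖a * b‖₊ ^ 2) = (gaussianReal 0 1).map (fun x => a * b * x) := by
    rw [gaussianReal_map_const_mul, mul_zero]
    congr 1
    ext
    simp [mul_pow]
  have hpi : (Measure.pi fun _ : Fin n × Fin m => gaussianReal 0 (‖a * b‖₊ ^ 2)) =
      (stdGaussianPi (Fin n × Fin m)).map (fun w => (a * b) • w) := by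
    rw [hlaw]
    exact (Measure.pi_map_pi (μ := fun _ : Fin n × Fin m => gaussianReal 0 1)
      (fun _ => (measurable_const_mul (a * b)).aemeasurable)).symm
  rw [gaussianOfFactors, ← MeasurableEquiv.map_symm_map (e := vecEquiv m n) (μ := iidGaussian m n (a * b)),
    map_vecEquiv_iidGaussian, hpi,
    Measure.map_map (vecEquiv m n).symm.measurable (measurable_const_smul _)]
  congr 1
  funext w
  simp [Matrix.smul_kronecker, Matrix.kronecker_smul, Matrix.smul_mulVec, smul_smul, mul_comm]

end Vec

/-! ### Privacy of additive Gaussian noise with given covariance factors -/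

section Mechanism

open scoped Kronecker

variable {m n : ℕ} {𝕏 : Type*}

theorem mul_mul_inv_cancel {U₁ : Matrix (Fin m) (Fin m) ℝ} {U₂ : Matrix (Fin n) (Fin n) ℝ}
    (h₁ : U₁.det ≠ 0) (h₂ : U₂.det ≠ 0) (M : Matrix (Fin m) (Fin n) ℝ) :
    U₁ * (U₁⁻¹ * M * (U₂⁻¹)ᵀ) * U₂ᵀ = M := by
  rw [Matrix.mul_assoc U₁⁻¹, Matrix.mul_nonsing_inv_cancel_left _ _ h₁.isUnit, Matrix.mul_assoc,
    ← Matrix.transpose_mul, Matrix.mul_nonsing_inv _ h₂.isUnit, Matrix.transpose_one,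
    Matrix.mul_one]

theorem inv_mul_mul_cancel {U₁ : Matrix (Fin m) (Fin m) ℝ} {U₂ : Matrix (Fin n) (Fin n) ℝ}
    (h₁ : U₁.det ≠ 0) (h₂ : U₂.det ≠ 0) (M : Matrix (Fin m) (Fin n) ℝ) :
    U₁⁻¹ * (U₁ * M * U₂ᵀ) * (U₂⁻¹)ᵀ = M := by
  rw [Matrix.mul_assoc U₁, Matrix.nonsing_inv_mul_cancel_left _ _ h₁.isUnit, Matrix.mul_assoc,
    ← Matrix.transpose_mul, Matrix.nonsing_inv_mul _ h₂.isUnit, Matrix.transpose_one,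
    Matrix.mul_one]

theorem measurable_matrix_apply (i : Fin m) (j : Fin n) :
    Measurable fun Z : Matrix (Fin m) (Fin n) ℝ => Z i j :=
  (measurable_pi_apply j).comp (measurable_pi_apply i)

theorem measurable_matrix_const_add (M : Matrix (Fin m) (Fin n) ℝ) :
    Measurable fun Z : Matrix (Fin m) (Fin n) ℝ => M + Z :=
  measurable_pi_lambda _ fun i => measurable_pi_lambda _ fun j =>
    (measurable_matrix_apply i j).const_add (M i j)

/-- The privacy of a pair of data sets depends only on the Frobenius norm of the difference of the
query values, measured in the coordinates in which the noise is standard. -/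
theorem forall_additiveMechanism_le_iff {ε δ B : ℝ} (hε : 0 < ε) (hδ : 0 ≤ δ) (hB : 0 < B)
    (hBδ : privacyCurve ε B = δ) {U₁ : Matrix (Fin m) (Fin m) ℝ} {U₂ : Matrix (Fin n) (Fin n) ℝ}
    (h₁ : U₁.det ≠ 0) (h₂ : U₂.det ≠ 0) (f : 𝕏 → Matrix (Fin m) (Fin n) ℝ) (X X' : 𝕏) :
    (∀ O, MeasurableSet O → additiveMechanism f (gaussianOfFactors U₁ U₂) X O ≤
      ENNReal.ofReal (Real.exp ε) * additiveMechanism f (gaussianOfFactors U₁ U₂) X' O +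
        ENNReal.ofReal δ) ↔ ‖U₁⁻¹ * (f X - f X') * (U₂⁻¹)ᵀ‖ ≤ B := by
  set D : Matrix (Fin m) (Fin n) ℝ := U₁⁻¹ * (f X - f X') * (U₂⁻¹)ᵀ with hD
  set A := U₂ ⊗ₖ U₁
  have hA : A.det ≠ 0 := det_kronecker_ne_zero h₁ h₂
  have hAD : A *ᵥ D.vec = (f X - f X').vec := by
    rw [Matrix.kronecker_mulVec_vec, hD, mul_mul_inv_cancel h₁ h₂]
  -- `T` sends standard Gaussian noise to the output on `X'`; translating the noise by `D` first
  -- gives the output on `X`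
  let addEquiv : Matrix (Fin m) (Fin n) ℝ ≃ᵐ Matrix (Fin m) (Fin n) ℝ :=
    { toEquiv := Equiv.addLeft (f X')
      measurable_toFun := measurable_matrix_const_add _
      measurable_invFun := measurable_matrix_const_add _ }
  let T := ((mulVecEquiv A hA).trans (vecEquiv m n).symm).trans addEquiv
  have hmeas : Measurable fun w => (vecEquiv m n).symm (A *ᵥ w) :=
    (vecEquiv m n).symm.measurable.comp (measurable_mulVec A)
  have hX' : additiveMechanism f (gaussianOfFactors U₁ U₂) X' = (stdGaussianPi _).map T :=
    Measure.map_map (measurable_matrix_const_add _) hmeas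
  have hX : additiveMechanism f (gaussianOfFactors U₁ U₂) X =
      ((stdGaussianPi _).map (· + D.vec)).map T := by
    rw [Measure.map_map T.measurable (measurable_add_const _)]
    refine (Measure.map_map (measurable_matrix_const_add _) hmeas).trans ?_
    congr 1
    funext w
    change f X + (vecEquiv m n).symm (A *ᵥ w) = f X' + (vecEquiv m n).symm (A *ᵥ (w + D.vec))
    rw [Matrix.mulVec_add, hAD]
    ext i j
    simp only [Matrix.add_apply, vecEquiv_symm_apply, Pi.add_apply, Matrix.vec, Matrix.sub_apply]
    ring
  have key : (∀ O, MeasurableSet O → additiveMechanism f (gaussianOfFactors U₁ U₂) X O ≤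
      ENNReal.ofReal (Real.exp ε) * additiveMechanism f (gaussianOfFactors U₁ U₂) X' O +
        ENNReal.ofReal δ) ↔
      ∀ O, MeasurableSet O → (stdGaussianPi _).map (· + D.vec) O ≤
        ENNReal.ofReal (Real.exp ε) * stdGaussianPi _ O + ENNReal.ofReal δ := by
    rw [hX, hX']
    simp only [T.map_apply]
    refine ⟨fun h O hO => ?_, fun h O hO => h _ (T.measurable hO)⟩
    have := h (T.symm ⁻¹' O) (T.symm.measurable hO)
    rwa [← Set.preimage_comp, T.symm_comp_self, Set.preimage_id] at this
  rw [key]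
  -- the privacy curve describes only positive distances
  rcases (norm_nonneg D).eq_or_lt with h0 | hpos
  · have hD0 : D.vec = 0 := by rw [norm_eq_zero.1 h0.symm, Matrix.vec_zero]
    refine iff_of_true (fun O _ => ?_) (h0 ▸ hB.le)
    simp only [hD0, add_zero, Measure.map_id']
    calc stdGaussianPi _ O = 1 * stdGaussianPi _ O := (one_mul _).symm
      _ ≤ ENNReal.ofReal (Real.exp ε) * stdGaussianPi _ O := by
        gcongr
        exact ENNReal.one_le_ofReal.2 (Real.one_le_exp hε.le)
      _ ≤ _ := le_self_add
  · rw [forall_map_add_right_le_iff _ hpos (norm_sq_eq_vec D).symm hδ, ← hBδ]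
    exact (strictMonoOn_privacyCurve ε).le_iff_le hpos hB

theorem isDP_gaussianOfFactors_iff {ε δ B : ℝ} (hε : 0 < ε) (hδ : 0 ≤ δ) (hB : 0 < B)
    (hBδ : privacyCurve ε B = δ) {U₁ : Matrix (Fin m) (Fin m) ℝ} {U₂ : Matrix (Fin n) (Fin n) ℝ}
    (h₁ : U₁.det ≠ 0) (h₂ : U₂.det ≠ 0) (Adj : 𝕏 → 𝕏 → Prop)
    (f : 𝕏 → Matrix (Fin m) (Fin n) ℝ) :
    IsDP Adj ε δ (additiveMechanism f (gaussianOfFactors U₁ U₂)) ↔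
      ∀ X X', Adj X X' → ‖U₁⁻¹ * (f X - f X') * (U₂⁻¹)ᵀ‖ ≤ B :=
  forall₃_congr fun X X' _ => forall_additiveMechanism_le_iff hε hδ hB hBδ h₁ h₂ f X X'

end Mechanism

/-! ### The smallest singular value -/

section MinSingularValue

variable {k m n : ℕ}

theorem minSingularValue_nonneg (U : Matrix (Fin k) (Fin k) ℝ) : 0 ≤ minSingularValue U :=
  LinearMap.singularValues_nonneg _ _

/-- Expand `‖U x‖² = ⟪Uᵀ U x, x⟫` in an eigenbasis of `Uᵀ U`, whose eigenvalues are the squares of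
the singular values. -/
theorem sq_minSingularValue_mul_norm_sq_le (U : Matrix (Fin k) (Fin k) ℝ)
    (x : EuclideanSpace ℝ (Fin k)) :
    minSingularValue U ^ 2 * ‖x‖ ^ 2 ≤ ‖Matrix.toEuclideanLin U x‖ ^ 2 := by
  set T := Matrix.toEuclideanLin U
  have hn : Module.finrank ℝ (EuclideanSpace ℝ (Fin k)) = k := finrank_euclideanSpace_fin
  have hS := T.isSymmetric_adjoint_comp_self
  let b := hS.eigenvectorBasis hn
  have hTx : ‖T x‖ ^ 2 = ∑ i, hS.eigenvalues hn i * inner ℝ (b i) x ^ 2 := by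
    rw [← real_inner_self_eq_norm_sq, ← LinearMap.adjoint_inner_left,
      ← b.sum_inner_mul_inner]
    refine Finset.sum_congr rfl fun i _ => ?_
    have h := hS x (b i)
    rw [hS.apply_eigenvectorBasis hn i, real_inner_smul_right] at h
    rw [LinearMap.comp_apply] at h
    rw [h, real_inner_comm (b i) x]
    simp only [RCLike.ofReal_real_eq_id, id]
    ring
  have hx : ‖x‖ ^ 2 = ∑ i, inner ℝ (b i) x ^ 2 := by
    rw [← b.sum_sq_norm_inner_right x]
    simp
  rw [hTx, hx, Finset.mul_sum]
  refine Finset.sum_le_sum fun i _ => mul_le_mul_of_nonneg_right ?_ (sq_nonneg _)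
  rw [← T.sq_singularValues_fin hn i]
  exact pow_le_pow_left₀ (minSingularValue_nonneg U)
    (T.singularValues_antitone (Nat.le_sub_one_of_lt i.2)) 2

theorem exists_norm_toEuclideanLin_eq (hk : 0 < k) (U : Matrix (Fin k) (Fin k) ℝ) :
    ∃ x : EuclideanSpace ℝ (Fin k), x ≠ 0 ∧
      ‖Matrix.toEuclideanLin U x‖ ^ 2 = minSingularValue U ^ 2 * ‖x‖ ^ 2 := by
  have hlt : k - 1 < Module.finrank ℝ (EuclideanSpace ℝ (Fin k)) := by
    rw [finrank_euclideanSpace_fin]; omega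
  obtain ⟨x, hx⟩ := ((Matrix.toEuclideanLin U).hasEigenvalue_adjoint_comp_self_sq_singularValues
    hlt).exists_hasEigenvector
  refine ⟨x, hx.2, ?_⟩
  have h := hx.apply_eq_smul
  rw [LinearMap.comp_apply] at h
  rw [← real_inner_self_eq_norm_sq, ← LinearMap.adjoint_inner_left, h, real_inner_smul_left,
    real_inner_self_eq_norm_sq]
  rfl

theorem sq_minSingularValue_mul_dotProduct_le (U : Matrix (Fin k) (Fin k) ℝ) (x : Fin k → ℝ) :
    minSingularValue U ^ 2 * (x ⬝ᵥ x) ≤ (U *ᵥ x) ⬝ᵥ (U *ᵥ x) := by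
  have h := sq_minSingularValue_mul_norm_sq_le U (WithLp.toLp 2 x)
  rw [EuclideanSpace.real_norm_sq_eq, EuclideanSpace.real_norm_sq_eq] at h
  simpa [dotProduct, pow_two] using h

theorem exists_mulVec_dotProduct_eq (hk : 0 < k) (U : Matrix (Fin k) (Fin k) ℝ) :
    ∃ x : Fin k → ℝ, 0 < x ⬝ᵥ x ∧
      (U *ᵥ x) ⬝ᵥ (U *ᵥ x) = minSingularValue U ^ 2 * (x ⬝ᵥ x) := by
  obtain ⟨x, hx0, hx⟩ := exists_norm_toEuclideanLin_eq hk U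
  have hpos : 0 < ‖x‖ ^ 2 := pow_pos (norm_pos_iff.2 hx0) 2
  rw [EuclideanSpace.real_norm_sq_eq] at hpos
  rw [EuclideanSpace.real_norm_sq_eq, EuclideanSpace.real_norm_sq_eq] at hx
  refine ⟨x.ofLp, ?_, ?_⟩
  · simpa [dotProduct, pow_two] using hpos
  · simpa [dotProduct, pow_two] using hx

theorem minSingularValue_pos (hk : 0 < k) {U : Matrix (Fin k) (Fin k) ℝ} (hU : U.det ≠ 0) :
    0 < minSingularValue U := by
  obtain ⟨x, hx0, hx⟩ := exists_mulVec_dotProduct_eq hk U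
  refine (minSingularValue_nonneg U).lt_of_ne fun h0 => ?_
  rw [← h0, zero_pow two_ne_zero, zero_mul, dotProduct_self_eq_zero] at hx
  rw [Matrix.eq_zero_of_mulVec_eq_zero hU hx, dotProduct_zero] at hx0
  exact hx0.false

theorem minSingularValue_smul_one (hk : 0 < k) {c : ℝ} (hc : 0 ≤ c) :
    minSingularValue (c • 1 : Matrix (Fin k) (Fin k) ℝ) = c := by
  obtain ⟨x, hx0, hx⟩ := exists_mulVec_dotProduct_eq hk (c • 1 : Matrix (Fin k) (Fin k) ℝ)
  rw [Matrix.smul_mulVec, Matrix.one_mulVec, smul_dotProduct, dotProduct_smul, smul_eq_mul,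
    smul_eq_mul, ← mul_assoc, ← pow_two] at hx
  exact ((sq_eq_sq₀ hc (minSingularValue_nonneg _)).1 (mul_right_cancel₀ hx0.ne' hx)).symm

theorem norm_sq_eq_sum_col (A : Matrix (Fin m) (Fin n) ℝ) :
    ‖A‖ ^ 2 = ∑ j, A.col j ⬝ᵥ A.col j := by
  rw [norm_sq_eq_vec, dotProduct, Fintype.sum_prod_type]
  rfl

theorem minSingularValue_mul_norm_le (U : Matrix (Fin m) (Fin m) ℝ)
    (A : Matrix (Fin m) (Fin n) ℝ) : minSingularValue U * ‖A‖ ≤ ‖U * A‖ := by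
  refine le_of_sq_le_sq ?_ (norm_nonneg _)
  rw [mul_pow, norm_sq_eq_sum_col, norm_sq_eq_sum_col, Finset.mul_sum]
  exact Finset.sum_le_sum fun j _ => sq_minSingularValue_mul_dotProduct_le U (A.col j)

/-- The two-sided product `D ↦ U₁ * D * U₂ᵀ` shrinks Frobenius norms at most by the product of the
smallest singular values. -/
theorem minSingularValue_mul_mul_norm_le (U₁ : Matrix (Fin m) (Fin m) ℝ)
    (U₂ : Matrix (Fin n) (Fin n) ℝ) (D : Matrix (Fin m) (Fin n) ℝ) :
    minSingularValue U₁ * minSingularValue U₂ * ‖D‖ ≤ ‖U₁ * D * U₂ᵀ‖ := by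
  calc minSingularValue U₁ * minSingularValue U₂ * ‖D‖
      = minSingularValue U₂ * (minSingularValue U₁ * ‖D‖) := by ring
    _ ≤ minSingularValue U₂ * ‖(U₁ * D)ᵀ‖ := by
        rw [Matrix.frobenius_norm_transpose]
        exact mul_le_mul_of_nonneg_left (minSingularValue_mul_norm_le U₁ D)
          (minSingularValue_nonneg U₂)
    _ ≤ ‖U₂ * (U₁ * D)ᵀ‖ := minSingularValue_mul_norm_le U₂ _
    _ = ‖U₁ * D * U₂ᵀ‖ := by
        rw [← Matrix.frobenius_norm_transpose (U₁ * D * U₂ᵀ), Matrix.transpose_mul (U₁ * D),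
          Matrix.transpose_transpose]

/-- The bound of `minSingularValue_mul_mul_norm_le` is attained, at the rank-one matrix built from
right singular vectors for the smallest singular values. -/
theorem exists_norm_mul_mul_eq (hm : 0 < m) (hn : 0 < n) (U₁ : Matrix (Fin m) (Fin m) ℝ)
    (U₂ : Matrix (Fin n) (Fin n) ℝ) : ∃ D : Matrix (Fin m) (Fin n) ℝ, ‖D‖ = 1 ∧
      ‖U₁ * D * U₂ᵀ‖ = minSingularValue U₁ * minSingularValue U₂ := by
  obtain ⟨x, hx0, hx⟩ := exists_mulVec_dotProduct_eq hm U₁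
  obtain ⟨y, hy0, hy⟩ := exists_mulVec_dotProduct_eq hn U₂
  have hvv : ∀ (u : Fin m → ℝ) (v : Fin n → ℝ),
      ‖Matrix.vecMulVec u v‖ ^ 2 = (u ⬝ᵥ u) * (v ⬝ᵥ v) := fun u v => by
    rw [norm_sq_eq_sum_col, dotProduct, dotProduct, Finset.sum_mul_sum, Finset.sum_comm]
    refine Finset.sum_congr rfl fun j _ => Finset.sum_congr rfl fun i _ => ?_
    simp only [Matrix.col_apply, Matrix.vecMulVec_apply]
    ring
  set E := Matrix.vecMulVec x y
  have hE : 0 < ‖E‖ := by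
    refine (norm_nonneg E).lt_of_ne fun h => ?_
    have := hvv x y
    rw [← h] at this
    exact (mul_pos hx0 hy0).ne (by simpa using this)
  have hUE : ‖U₁ * E * U₂ᵀ‖ = minSingularValue U₁ * minSingularValue U₂ * ‖E‖ := by
    rw [← sq_eq_sq₀ (norm_nonneg _) (mul_nonneg (mul_nonneg (minSingularValue_nonneg _)
      (minSingularValue_nonneg _)) (norm_nonneg _)), Matrix.mul_vecMulVec, Matrix.vecMulVec_mul,
      Matrix.vecMul_transpose, hvv, mul_pow, mul_pow, hvv, hx, hy]
    ring
  refine ⟨‖E‖⁻¹ • E, ?_, ?_⟩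
  · rw [norm_smul, norm_inv, norm_norm, inv_mul_cancel₀ hE.ne']
  · rw [Matrix.mul_smul, Matrix.smul_mul, norm_smul, norm_inv, norm_norm, hUE]
    field_simp

end MinSingularValue

/-! ### Second moments and optimality -/

section Optimality

open scoped Kronecker

variable {k m n : ℕ}

theorem lintegral_enorm_sq_gaussianReal (v : ℝ≥0) : ∫⁻ x, ‖x‖ₑ ^ 2 ∂gaussianReal 0 v = v := by
  have h := (memLp_id_gaussianReal (μ := 0) (v := v) 2).ofReal_variance_eq
  rw [variance_id_gaussianReal, ENNReal.ofReal_coe_nnreal, evariance] at h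
  simpa using h.symm

theorem lintegral_entry_gaussianOfFactors (U₁ : Matrix (Fin m) (Fin m) ℝ)
    (U₂ : Matrix (Fin n) (Fin n) ℝ) (i : Fin m) (j : Fin n) :
    ∫⁻ Z, ‖Z i j‖ₑ ^ 2 ∂gaussianOfFactors U₁ U₂ =
      ENNReal.ofReal ((U₁ * U₁ᵀ) i i * (U₂ * U₂ᵀ) j j) := by
  have hmeas : Measurable fun w => (vecEquiv m n).symm ((U₂ ⊗ₖ U₁) *ᵥ w) :=
    (vecEquiv m n).symm.measurable.comp (measurable_mulVec _)
  have hent : Measurable fun Z : Matrix (Fin m) (Fin n) ℝ => ‖Z i j‖ₑ ^ 2 :=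
    (measurable_matrix_apply i j).enorm.pow_const 2
  have hdot : Measurable fun w : Fin n × Fin m → ℝ => (U₂ ⊗ₖ U₁) (j, i) ⬝ᵥ w := by
    unfold dotProduct; fun_prop
  rw [gaussianOfFactors, lintegral_map hent hmeas]
  have hlaw := map_dotProduct_stdGaussianPi ((U₂ ⊗ₖ U₁) (j, i))
  have hint := lintegral_map (μ := stdGaussianPi (Fin n × Fin m))
    (f := fun x : ℝ => ‖x‖ₑ ^ 2) (by fun_prop) hdot
  rw [hlaw, lintegral_enorm_sq_gaussianReal] at hint
  refine hint.symm.trans ?_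
  rw [ENNReal.ofReal]
  congr 2
  rw [mul_comm, Matrix.mul_apply, Matrix.mul_apply, Finset.sum_mul_sum, dotProduct,
    Fintype.sum_prod_type]
  refine Finset.sum_congr rfl fun q _ => Finset.sum_congr rfl fun p _ => ?_
  simp only [Matrix.kronecker_apply, Matrix.transpose_apply]
  ring

theorem enorm_sq_eq_sum (Z : Matrix (Fin m) (Fin n) ℝ) :
    ‖Z‖ₑ ^ 2 = ∑ i, ∑ j, ‖Z i j‖ₑ ^ 2 := by
  have h : ‖Z‖₊ ^ 2 = ∑ i, ∑ j, ‖Z i j‖₊ ^ 2 := by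
    rw [Matrix.frobenius_nnnorm_def, ← NNReal.sqrt_eq_rpow, NNReal.sq_sqrt]
    simp
  simp only [enorm_eq_nnnorm]
  exact_mod_cast h

theorem lintegral_enorm_sq_gaussianOfFactors (U₁ : Matrix (Fin m) (Fin m) ℝ)
    (U₂ : Matrix (Fin n) (Fin n) ℝ) :
    ∫⁻ Z, ‖Z‖ₑ ^ 2 ∂gaussianOfFactors U₁ U₂ =
      ∑ i, ∑ j, ENNReal.ofReal ((U₁ * U₁ᵀ) i i * (U₂ * U₂ᵀ) j j) := by
  have hent : ∀ (i : Fin m) (j : Fin n),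
      Measurable fun Z : Matrix (Fin m) (Fin n) ℝ => ‖Z i j‖ₑ ^ 2 := fun i j =>
    (measurable_matrix_apply i j).enorm.pow_const 2
  simp only [enorm_sq_eq_sum]
  rw [lintegral_finsetSum _ fun i _ => Finset.measurable_sum _ fun j _ => hent i j]
  refine Finset.sum_congr rfl fun i _ => ?_
  rw [lintegral_finsetSum _ fun j _ => hent i j]
  exact Finset.sum_congr rfl fun j _ => lintegral_entry_gaussianOfFactors U₁ U₂ i j

theorem det_ne_zero_of_mul_transpose_posDef {S U : Matrix (Fin k) (Fin k) ℝ} (hS : S.PosDef)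
    (hU : U * Uᵀ = S) : U.det ≠ 0 := by
  intro h
  have := hS.det_pos
  rw [← hU, Matrix.det_mul, h, zero_mul] at this
  exact this.false

open scoped MatrixOrder in
/-- A symmetric factor makes `Uᵀ * U` and `U * Uᵀ` agree, so that `minSingularValue U ^ 2` bounds the
quadratic form of the covariance itself. -/
theorem exists_symm_sqrt {S : Matrix (Fin k) (Fin k) ℝ} (hS : S.PosDef) :
    ∃ U : Matrix (Fin k) (Fin k) ℝ, Uᵀ = U ∧ U * Uᵀ = S := by
  have hsymm : (CFC.sqrt S)ᵀ = CFC.sqrt S := by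
    have h := (Matrix.nonneg_iff_posSemidef.1 (CFC.sqrt_nonneg S)).isHermitian
    rwa [Matrix.IsHermitian, Matrix.conjTranspose_eq_transpose_of_trivial] at h
  refine ⟨CFC.sqrt S, hsymm, ?_⟩
  rw [hsymm, CFC.sqrt_mul_sqrt_self S hS.posSemidef.nonneg]

theorem sq_minSingularValue_le_diag {S U : Matrix (Fin k) (Fin k) ℝ} (hsymm : Uᵀ = U)
    (hU : U * Uᵀ = S) (i : Fin k) : minSingularValue U ^ 2 ≤ S i i := by
  have h := sq_minSingularValue_mul_dotProduct_le U (Pi.single i 1)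
  have hS : S i i = U.col i ⬝ᵥ U.col i := by
    rw [← hU, show U * Uᵀ = Uᵀ * U by rw [hsymm], Matrix.mul_apply]
    rfl
  rw [hS]
  simpa using h

/-- A positive definite matrix whose diagonal entries all equal the smallest eigenvalue is scalar:
subtracting that multiple of the identity leaves a positive semidefinite matrix of trace zero. -/
theorem eq_smul_one_of_diag_eq {S U : Matrix (Fin k) (Fin k) ℝ} (hsymm : Uᵀ = U)
    (hU : U * Uᵀ = S) (h : ∀ i, S i i = minSingularValue U ^ 2) :
    S = minSingularValue U ^ 2 • 1 := by
  have hST : Sᵀ = S := by rw [← hU, Matrix.transpose_mul, Matrix.transpose_transpose]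
  have hpsd : (S - minSingularValue U ^ 2 • 1).PosSemidef := by
    refine .of_dotProduct_mulVec_nonneg ?_ fun x => ?_
    · rw [Matrix.IsHermitian, Matrix.conjTranspose_eq_transpose_of_trivial,
        Matrix.transpose_sub, hST, Matrix.transpose_smul, Matrix.transpose_one]
    · have hx := sq_minSingularValue_mul_dotProduct_le U x
      have hquad : x ⬝ᵥ (S *ᵥ x) = (U *ᵥ x) ⬝ᵥ (U *ᵥ x) := by
        rw [← hU, ← Matrix.mulVec_mulVec, Matrix.dotProduct_mulVec, ← Matrix.mulVec_transpose,
          hsymm]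
      rw [star_trivial, Matrix.sub_mulVec, dotProduct_sub, hquad, Matrix.smul_mulVec,
        Matrix.one_mulVec, dotProduct_smul, smul_eq_mul]
      exact sub_nonneg.2 hx
  refine sub_eq_zero.1 (hpsd.trace_eq_zero_iff.1 ?_)
  simp only [Matrix.trace, Matrix.diag, Matrix.sub_apply, h, Matrix.smul_apply,
    Matrix.one_apply_eq, smul_eq_mul, mul_one, sub_self, Finset.sum_const_zero]

theorem det_smul_one_ne_zero {a : ℝ} (ha : 0 < a) : (a • 1 : Matrix (Fin k) (Fin k) ℝ).det ≠ 0 := by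
  rw [Matrix.det_smul, Matrix.det_one, mul_one]
  exact pow_ne_zero _ ha.ne'

theorem smul_one_mul_transpose (a : ℝ) :
    (a • 1 : Matrix (Fin k) (Fin k) ℝ) * (a • 1 : Matrix (Fin k) (Fin k) ℝ)ᵀ = a ^ 2 • 1 := by
  rw [Matrix.transpose_smul, Matrix.transpose_one, Matrix.smul_mul, Matrix.one_mul, smul_smul,
    pow_two]

/-- The tight case of the product bound for the diagonals `a`, `b` of two covariances with smallest
eigenvalues `α`, `β`. -/
theorem eq_of_mul_eq_of_le {a b α β : ℝ} (hα : 0 < α) (hβ : 0 < β) (ha : α ≤ a) (hb : β ≤ b)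
    {C : ℝ} (hC : C ≤ α * β) (h : a * b = C) : a = α ∧ b = β := by
  constructor
  · refine le_antisymm (le_of_not_gt fun hlt => ?_) ha
    nlinarith [mul_lt_mul_of_pos_right hlt hβ, mul_le_mul_of_nonneg_left hb (hα.le.trans ha)]
  · refine le_antisymm (le_of_not_gt fun hlt => ?_) hb
    nlinarith [mul_lt_mul_of_pos_left hlt hα, mul_le_mul_of_nonneg_right ha (hβ.le.trans hb)]

/-- If a class of matrix Gaussian laws is cut out by a lower bound `c` on the product of the
smallest singular values of the factors, then independent entries of standard deviation `c` are
optimal in it. -/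
theorem isOptimalNoise_iidGaussian (hm : 0 < m) (hn : 0 < n) {c : ℝ} (hc : 0 < c)
    (P : Measure (Matrix (Fin m) (Fin n) ℝ) → Prop)
    (hP : ∀ (S₁ U₁ : Matrix (Fin m) (Fin m) ℝ) (S₂ U₂ : Matrix (Fin n) (Fin n) ℝ),
      S₁.PosDef → S₂.PosDef → U₁ * U₁ᵀ = S₁ → U₂ * U₂ᵀ = S₂ →
      (P (matrixGaussian 0 S₁ S₂) ↔ minSingularValue U₁ * minSingularValue U₂ ≥ c)) :
    IsOptimalNoise {μ | ∃ (S₁ : Matrix (Fin m) (Fin m) ℝ) (S₂ : Matrix (Fin n) (Fin n) ℝ),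
      S₁.PosDef ∧ S₂.PosDef ∧ μ = matrixGaussian 0 S₁ S₂ ∧ P μ} (iidGaussian m n c) := by
  have hiid : iidGaussian m n c = gaussianOfFactors (c • 1) ((1 : ℝ) • 1) := by
    rw [← iidGaussian_mul_eq_gaussianOfFactors, mul_one]
  have hpd : ∀ {k : ℕ} {a : ℝ}, 0 < a → (a ^ 2 • 1 : Matrix (Fin k) (Fin k) ℝ).PosDef :=
    fun ha => Matrix.PosDef.one.smul (pow_pos ha 2)
  have hentry : ∀ i j, ∫⁻ Z, ‖Z i j‖ₑ ^ 2 ∂iidGaussian m n c = ENNReal.ofReal (c ^ 2) :=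
    fun i j => by
      rw [hiid, lintegral_entry_gaussianOfFactors, smul_one_mul_transpose, smul_one_mul_transpose]
      simp
  have henergy : ∫⁻ Z, ‖Z‖ₑ ^ 2 ∂iidGaussian m n c =
      ∑ _i : Fin m, ∑ _j : Fin n, ENNReal.ofReal (c ^ 2) := by
    rw [hiid, lintegral_enorm_sq_gaussianOfFactors, smul_one_mul_transpose, smul_one_mul_transpose]
    simp
  -- every law in the class has factors that are symmetric square roots of the covariances
  have hclass : ∀ μ, (∃ (S₁ : Matrix (Fin m) (Fin m) ℝ) (S₂ : Matrix (Fin n) (Fin n) ℝ),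
      S₁.PosDef ∧ S₂.PosDef ∧ μ = matrixGaussian 0 S₁ S₂ ∧ P μ) →
      ∃ (U₁ : Matrix (Fin m) (Fin m) ℝ) (U₂ : Matrix (Fin n) (Fin n) ℝ),
        U₁ᵀ = U₁ ∧ U₂ᵀ = U₂ ∧ U₁.det ≠ 0 ∧ U₂.det ≠ 0 ∧
        c ≤ minSingularValue U₁ * minSingularValue U₂ ∧ μ = gaussianOfFactors U₁ U₂ := by
    rintro μ ⟨S₁, S₂, hS₁, hS₂, rfl, hμ⟩
    obtain ⟨U₁, hs₁, hU₁⟩ := exists_symm_sqrt hS₁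
    obtain ⟨U₂, hs₂, hU₂⟩ := exists_symm_sqrt hS₂
    have h₁ := det_ne_zero_of_mul_transpose_posDef hS₁ hU₁
    have h₂ := det_ne_zero_of_mul_transpose_posDef hS₂ hU₂
    refine ⟨U₁, U₂, hs₁, hs₂, h₁, h₂, (hP S₁ U₁ S₂ U₂ hS₁ hS₂ hU₁ hU₂).1 hμ, ?_⟩
    rw [← matrixGaussian_eq_gaussianOfFactors h₁ h₂, hU₁, hU₂]
  have hdiag : ∀ (U₁ : Matrix (Fin m) (Fin m) ℝ) (U₂ : Matrix (Fin n) (Fin n) ℝ), U₁ᵀ = U₁ →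
      U₂ᵀ = U₂ → c ≤ minSingularValue U₁ * minSingularValue U₂ → ∀ i j,
      c ^ 2 ≤ (U₁ * U₁ᵀ) i i * (U₂ * U₂ᵀ) j j := fun U₁ U₂ hs₁ hs₂ hcU i j =>
    calc c ^ 2 ≤ (minSingularValue U₁ * minSingularValue U₂) ^ 2 := pow_le_pow_left₀ hc.le hcU 2
      _ = minSingularValue U₁ ^ 2 * minSingularValue U₂ ^ 2 := mul_pow _ _ _
      _ ≤ _ := mul_le_mul (sq_minSingularValue_le_diag hs₁ rfl i)
        (sq_minSingularValue_le_diag hs₂ rfl j) (sq_nonneg _)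
        ((sq_nonneg _).trans (sq_minSingularValue_le_diag hs₁ rfl i))
  refine ⟨?_, fun μ hμ i j => ?_, fun μ hμ => ?_, fun μ hμ heq => ?_⟩
  · refine ⟨c ^ 2 • 1, 1 ^ 2 • 1, hpd hc, hpd one_pos, ?_, ?_⟩
    · rw [hiid, ← matrixGaussian_eq_gaussianOfFactors (det_smul_one_ne_zero hc) (det_smul_one_ne_zero one_pos),
        smul_one_mul_transpose, smul_one_mul_transpose]
    · rw [hiid, ← matrixGaussian_eq_gaussianOfFactors (det_smul_one_ne_zero hc) (det_smul_one_ne_zero one_pos)]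
      refine (hP _ _ _ _ ?_ ?_ rfl rfl).2 ?_
      · rw [smul_one_mul_transpose]; exact hpd hc
      · rw [smul_one_mul_transpose]; exact hpd one_pos
      · rw [minSingularValue_smul_one hm hc.le, minSingularValue_smul_one hn zero_le_one, mul_one]
  · obtain ⟨U₁, U₂, hs₁, hs₂, -, -, hcU, rfl⟩ := hclass μ hμ
    rw [hentry, lintegral_entry_gaussianOfFactors]
    exact ENNReal.ofReal_le_ofReal (hdiag U₁ U₂ hs₁ hs₂ hcU i j)
  · obtain ⟨U₁, U₂, hs₁, hs₂, -, -, hcU, rfl⟩ := hclass μ hμ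
    rw [henergy, lintegral_enorm_sq_gaussianOfFactors]
    exact Finset.sum_le_sum fun i _ => Finset.sum_le_sum fun j _ =>
      ENNReal.ofReal_le_ofReal (hdiag U₁ U₂ hs₁ hs₂ hcU i j)
  · obtain ⟨U₁, U₂, hs₁, hs₂, h₁, h₂, hcU, rfl⟩ := hclass μ hμ
    have hd := hdiag U₁ U₂ hs₁ hs₂ hcU
    have hσ₁ := minSingularValue_pos hm h₁
    have hσ₂ := minSingularValue_pos hn h₂
    -- equal energies force equality in every entry
    have hentries : ∀ i j, (U₁ * U₁ᵀ) i i * (U₂ * U₂ᵀ) j j = c ^ 2 := by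
      rw [henergy, lintegral_enorm_sq_gaussianOfFactors] at heq
      simp only [← Fintype.sum_prod_type'] at heq
      rw [← ENNReal.ofReal_sum_of_nonneg fun p _ => (sq_nonneg c).trans (hd p.1 p.2),
        ← ENNReal.ofReal_sum_of_nonneg fun p _ => sq_nonneg c,
        ENNReal.ofReal_eq_ofReal_iff
          (Finset.sum_nonneg fun p _ => (sq_nonneg c).trans (hd p.1 p.2))
          (Finset.sum_nonneg fun p _ => sq_nonneg c)] at heq
      intro i j
      exact ((Finset.sum_eq_sum_iff_of_le fun (p : Fin m × Fin n) _ => hd p.1 p.2).1 heq.symm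
        (i, j) (Finset.mem_univ _)).symm
    have hc2 : c ^ 2 ≤ minSingularValue U₁ ^ 2 * minSingularValue U₂ ^ 2 := by
      rw [← mul_pow]; exact pow_le_pow_left₀ hc.le hcU 2
    have htight : ∀ i j, (U₁ * U₁ᵀ) i i = minSingularValue U₁ ^ 2 ∧
        (U₂ * U₂ᵀ) j j = minSingularValue U₂ ^ 2 := fun i j =>
      eq_of_mul_eq_of_le (pow_pos hσ₁ 2) (pow_pos hσ₂ 2) (sq_minSingularValue_le_diag hs₁ rfl i)
        (sq_minSingularValue_le_diag hs₂ rfl j) hc2 (hentries i j)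
    have hS₁ := eq_smul_one_of_diag_eq hs₁ rfl fun i => (htight i ⟨0, hn⟩).1
    have hS₂ := eq_smul_one_of_diag_eq hs₂ rfl fun j => (htight ⟨0, hm⟩ j).2
    have hprod : minSingularValue U₁ * minSingularValue U₂ = c := by
      have h := hentries ⟨0, hm⟩ ⟨0, hn⟩
      rw [(htight ⟨0, hm⟩ ⟨0, hn⟩).1, (htight ⟨0, hm⟩ ⟨0, hn⟩).2, ← mul_pow] at h
      exact (sq_eq_sq₀ (mul_pos hσ₁ hσ₂).le hc.le).1 h
    rw [← matrixGaussian_eq_gaussianOfFactors h₁ h₂, hS₁, hS₂, ← smul_one_mul_transpose,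
      ← smul_one_mul_transpose, matrixGaussian_eq_gaussianOfFactors (det_smul_one_ne_zero hσ₁) (det_smul_one_ne_zero hσ₂),
      ← iidGaussian_mul_eq_gaussianOfFactors, hprod]

end Optimality

/-! ### Privacy in terms of the smallest singular values -/

section Criterion

variable {m n : ℕ} {𝕏 : Type*} {Adj : 𝕏 → 𝕏 → Prop} {ε δ B : ℝ}

theorem norm_sub_le_of_l2Sensitivity_eq {f : 𝕏 → Matrix (Fin m) (Fin n) ℝ} {s : ℝ≥0}
    (hf : l2Sensitivity Adj f = s) {X X' : 𝕏} (h : Adj X X') : ‖f X - f X'‖ ≤ s := by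
  have hle : ‖f X - f X'‖ₑ ≤ l2Sensitivity Adj f :=
    le_iSup_of_le X (le_iSup_of_le X' (le_iSup_of_le h le_rfl))
  rw [hf, enorm_eq_nnnorm, ENNReal.coe_le_coe] at hle
  exact hle

theorem isDP_of_le_minSingularValue (hm : 0 < m) (hn : 0 < n) (hε : 0 < ε) (hδ : 0 ≤ δ)
    (hB : 0 < B) (hBδ : privacyCurve ε B = δ) {U₁ : Matrix (Fin m) (Fin m) ℝ}
    {U₂ : Matrix (Fin n) (Fin n) ℝ} (h₁ : U₁.det ≠ 0) (h₂ : U₂.det ≠ 0)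
    {f : 𝕏 → Matrix (Fin m) (Fin n) ℝ} {s : ℝ≥0} (hf : l2Sensitivity Adj f = s)
    (hs : (s : ℝ) / B ≤ minSingularValue U₁ * minSingularValue U₂) :
    IsDP Adj ε δ (additiveMechanism f (gaussianOfFactors U₁ U₂)) := by
  refine (isDP_gaussianOfFactors_iff hε hδ hB hBδ h₁ h₂ Adj f).2 fun X X' h => ?_
  have hσ := mul_pos (minSingularValue_pos hm h₁) (minSingularValue_pos hn h₂)
  have hle := minSingularValue_mul_mul_norm_le U₁ U₂ (U₁⁻¹ * (f X - f X') * (U₂⁻¹)ᵀ)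
  rw [mul_mul_inv_cancel h₁ h₂] at hle
  refine le_of_mul_le_mul_left ?_ hσ
  exact (hle.trans (norm_sub_le_of_l2Sensitivity_eq hf h)).trans ((div_le_iff₀ hB).1 hs)

/-- A difference of norm `s` that is hardest to hide: in the coordinates of the noise it has the
largest possible norm. -/
theorem exists_worst_difference (hm : 0 < m) (hn : 0 < n) {U₁ : Matrix (Fin m) (Fin m) ℝ}
    {U₂ : Matrix (Fin n) (Fin n) ℝ} (h₁ : U₁.det ≠ 0) (h₂ : U₂.det ≠ 0) (s : ℝ≥0) :
    ∃ Δ : Matrix (Fin m) (Fin n) ℝ, ‖Δ‖ = s ∧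
      minSingularValue U₁ * minSingularValue U₂ * ‖U₁⁻¹ * Δ * (U₂⁻¹)ᵀ‖ = s := by
  have hσ := mul_pos (minSingularValue_pos hm h₁) (minSingularValue_pos hn h₂)
  obtain ⟨D, hD, hUD⟩ := exists_norm_mul_mul_eq hm hn U₁ U₂
  set r : ℝ := s / (minSingularValue U₁ * minSingularValue U₂) with hr
  have hr0 : 0 ≤ r := div_nonneg s.2 hσ.le
  refine ⟨U₁ * (r • D) * U₂ᵀ, ?_, ?_⟩
  · rw [Matrix.mul_smul, Matrix.smul_mul, norm_smul, hUD, Real.norm_of_nonneg hr0, hr,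
      div_mul_cancel₀ _ hσ.ne']
  · rw [inv_mul_mul_cancel h₁ h₂, norm_smul, hD, mul_one, Real.norm_of_nonneg hr0, hr,
      mul_div_cancel₀ _ hσ.ne']

/-- The lower bound on the noise is necessary for a query whose differences come arbitrarily close
to every matrix of norm `s`, in particular to the worst one. -/
theorem le_minSingularValue_of_isDP_of_dense (hm : 0 < m) (hn : 0 < n) (hε : 0 < ε) (hδ : 0 ≤ δ)
    (hB : 0 < B) (hBδ : privacyCurve ε B = δ) {U₁ : Matrix (Fin m) (Fin m) ℝ}
    {U₂ : Matrix (Fin n) (Fin n) ℝ} (h₁ : U₁.det ≠ 0) (h₂ : U₂.det ≠ 0)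
    {f : 𝕏 → Matrix (Fin m) (Fin n) ℝ} {s : ℝ≥0}
    (hdense : ∀ Δ : Matrix (Fin m) (Fin n) ℝ, ‖Δ‖ = s → ∀ η : ℝ, 0 < η →
      ∃ X X' : 𝕏, Adj X X' ∧ ‖(f X - f X') - Δ‖ < η)
    (hDP : IsDP Adj ε δ (additiveMechanism f (gaussianOfFactors U₁ U₂))) :
    (s : ℝ) / B ≤ minSingularValue U₁ * minSingularValue U₂ := by
  have hσ := mul_pos (minSingularValue_pos hm h₁) (minSingularValue_pos hn h₂)
  obtain ⟨Δ, hΔ, hworst⟩ := exists_worst_difference hm hn h₁ h₂ s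
  rw [div_le_iff₀ hB]
  refine le_of_forall_pos_le_add fun η hη => ?_
  obtain ⟨X, X', hadj, hclose⟩ := hdense Δ hΔ η hη
  have hX := (isDP_gaussianOfFactors_iff hε hδ hB hBδ h₁ h₂ Adj f).1 hDP X X' hadj
  have hle := minSingularValue_mul_mul_norm_le U₁ U₂ (U₁⁻¹ * ((f X - f X') - Δ) * (U₂⁻¹)ᵀ)
  rw [mul_mul_inv_cancel h₁ h₂] at hle
  have htri : ‖U₁⁻¹ * Δ * (U₂⁻¹)ᵀ‖ ≤
      ‖U₁⁻¹ * (f X - f X') * (U₂⁻¹)ᵀ‖ + ‖U₁⁻¹ * ((f X - f X') - Δ) * (U₂⁻¹)ᵀ‖ := by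
    rw [Matrix.mul_sub _ (f X - f X'), Matrix.sub_mul (U₁⁻¹ * (f X - f X'))]
    exact norm_le_norm_add_norm_sub _ _
  calc (s : ℝ) = minSingularValue U₁ * minSingularValue U₂ * ‖U₁⁻¹ * Δ * (U₂⁻¹)ᵀ‖ := hworst.symm
    _ ≤ minSingularValue U₁ * minSingularValue U₂ *
        (‖U₁⁻¹ * (f X - f X') * (U₂⁻¹)ᵀ‖ + ‖U₁⁻¹ * ((f X - f X') - Δ) * (U₂⁻¹)ᵀ‖) :=
      mul_le_mul_of_nonneg_left htri hσ.le
    _ ≤ minSingularValue U₁ * minSingularValue U₂ * B + η := by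
      rw [mul_add]
      exact add_le_add (mul_le_mul_of_nonneg_left hX hσ.le) (hle.trans hclose.le)

/-- Some query of sensitivity `‖Δ‖` has the difference `Δ` on a given pair of distinct adjacent
data sets: the query that takes the value `Δ` at one point and vanishes elsewhere. -/
theorem exists_query_sub_eq {X X' : 𝕏} (hadj : Adj X X') (hne : X ≠ X')
    (Δ : Matrix (Fin m) (Fin n) ℝ) :
    ∃ f : 𝕏 → Matrix (Fin m) (Fin n) ℝ, l2Sensitivity Adj f = ‖Δ‖₊ ∧ f X - f X' = Δ := by
  classical
  have hsub : (if X = X then Δ else 0) - (if X' = X then Δ else 0) = Δ := by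
    rw [if_pos rfl, if_neg hne.symm, sub_zero]
  refine ⟨fun Y => if Y = X then Δ else 0, le_antisymm ?_ ?_, hsub⟩
  · refine iSup_le fun Y => iSup_le fun Y' => iSup_le fun _ => ?_
    rw [enorm_eq_nnnorm, ENNReal.coe_le_coe]
    by_cases h : Y = X <;> by_cases h' : Y' = X <;> simp [h, h']
  · refine le_iSup_of_le X (le_iSup_of_le X' (le_iSup_of_le hadj ?_))
    rw [hsub, enorm_eq_nnnorm]

theorem le_minSingularValue_of_forall_isDP (hm : 0 < m) (hn : 0 < n) (hε : 0 < ε) (hδ : 0 ≤ δ)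
    (hB : 0 < B) (hBδ : privacyCurve ε B = δ) {U₁ : Matrix (Fin m) (Fin m) ℝ}
    {U₂ : Matrix (Fin n) (Fin n) ℝ} (h₁ : U₁.det ≠ 0) (h₂ : U₂.det ≠ 0) {X X' : 𝕏}
    (hadj : Adj X X') (hne : X ≠ X') {s : ℝ≥0}
    (hDP : ∀ f : 𝕏 → Matrix (Fin m) (Fin n) ℝ, l2Sensitivity Adj f = s →
      IsDP Adj ε δ (additiveMechanism f (gaussianOfFactors U₁ U₂))) :
    (s : ℝ) / B ≤ minSingularValue U₁ * minSingularValue U₂ := by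
  have hσ := mul_pos (minSingularValue_pos hm h₁) (minSingularValue_pos hn h₂)
  obtain ⟨Δ, hΔ, hworst⟩ := exists_worst_difference hm hn h₁ h₂ s
  obtain ⟨f, hf, hsub⟩ := exists_query_sub_eq hadj hne Δ
  have hΔ' : ‖Δ‖₊ = s := NNReal.eq hΔ
  have h := (isDP_gaussianOfFactors_iff hε hδ hB hBδ h₁ h₂ Adj f).1 (hDP f (by rw [hf, hΔ']))
    X X' hadj
  rw [hsub] at h
  rw [div_le_iff₀ hB, ← hworst]
  exact mul_le_mul_of_nonneg_left h hσ.le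

theorem isDP_iidGaussian (hm : 0 < m) (hn : 0 < n) (hε : 0 < ε) (hδ : 0 ≤ δ)
    (hB : 0 < B) (hBδ : privacyCurve ε B = δ) {f : 𝕏 → Matrix (Fin m) (Fin n) ℝ} {s : ℝ≥0}
    (hf : l2Sensitivity Adj f = s) :
    IsDP Adj ε δ (additiveMechanism f (iidGaussian m n (s / B))) := by
  rcases s.2.eq_or_lt with hs | hs
  · -- a query of sensitivity zero is constant on adjacent data sets
    intro X X' hadj O _
    have hXX' : f X = f X' := by
      have h := norm_sub_le_of_l2Sensitivity_eq hf hadj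
      exact sub_eq_zero.1 (norm_le_zero_iff.1 (h.trans hs.ge))
    rw [show additiveMechanism f (iidGaussian m n (s / B)) X =
      additiveMechanism f (iidGaussian m n (s / B)) X' by rw [additiveMechanism, hXX']; rfl]
    exact (le_mul_of_one_le_left' (ENNReal.one_le_ofReal.2 (Real.one_le_exp hε.le))).trans
      le_self_add
  · have hc : 0 < (s : ℝ) / B := div_pos hs hB
    rw [← mul_one ((s : ℝ) / B), iidGaussian_mul_eq_gaussianOfFactors]
    refine isDP_of_le_minSingularValue hm hn hε hδ hB hBδ (det_smul_one_ne_zero hc) (det_smul_one_ne_zero one_pos) hf ?_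
    rw [minSingularValue_smul_one hm hc.le, minSingularValue_smul_one hn zero_le_one, mul_one]

end Criterion

end MatrixDP

theorem mainTheorem1 {m n : ℕ} (hm : 0 < m) (hn : 0 < n) {𝕏 : Type*} (Adj : 𝕏 → 𝕏 → Prop)
    {ε δ : ℝ} (hε : 0 < ε) (hδ₀ : 0 < δ) (hδ₁ : δ < 1) :
    -- the equation `g(x) = δ` has exactly one root `B`
    (∃! B : ℝ, 0 < B ∧ MatrixDP.privacyCurve ε B = δ) ∧
    ∀ B : ℝ, 0 < B → MatrixDP.privacyCurve ε B = δ →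
      -- a fixed query `f` of sensitivity `s`
      (∀ (f : 𝕏 → Matrix (Fin m) (Fin n) ℝ) (s : ℝ≥0),
        MatrixDP.l2Sensitivity Adj f = (s : ℝ≥0∞) →
        (∀ (S₁ U₁ : Matrix (Fin m) (Fin m) ℝ) (S₂ U₂ : Matrix (Fin n) (Fin n) ℝ),
          S₁.PosDef → S₂.PosDef → U₁ * U₁ᵀ = S₁ → U₂ * U₂ᵀ = S₂ →
          (s : ℝ) / B ≤ MatrixDP.minSingularValue U₁ * MatrixDP.minSingularValue U₂ →
          MatrixDP.IsDP Adj ε δ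
            (MatrixDP.additiveMechanism f (MatrixDP.matrixGaussian 0 S₁ S₂))) ∧
        MatrixDP.IsDP Adj ε δ
          (MatrixDP.additiveMechanism f (MatrixDP.iidGaussian m n ((s : ℝ) / B))) ∧
        -- every `Δ` of norm `s` is a limit of differences of `f` on adjacent inputs
        ((∀ Δ : Matrix (Fin m) (Fin n) ℝ, ‖Δ‖ = s → ∀ η : ℝ, 0 < η →
            ∃ X X' : 𝕏, Adj X X' ∧ ‖(f X - f X') - Δ‖ < η) →
          (∀ (S₁ U₁ : Matrix (Fin m) (Fin m) ℝ) (S₂ U₂ : Matrix (Fin n) (Fin n) ℝ),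
            S₁.PosDef → S₂.PosDef → U₁ * U₁ᵀ = S₁ → U₂ * U₂ᵀ = S₂ →
            (MatrixDP.IsDP Adj ε δ
                (MatrixDP.additiveMechanism f (MatrixDP.matrixGaussian 0 S₁ S₂)) ↔
              MatrixDP.minSingularValue U₁ * MatrixDP.minSingularValue U₂ ≥ (s : ℝ) / B)) ∧
          (0 < s → MatrixDP.IsOptimalNoise
            {μ | ∃ (S₁ : Matrix (Fin m) (Fin m) ℝ) (S₂ : Matrix (Fin n) (Fin n) ℝ),
              S₁.PosDef ∧ S₂.PosDef ∧ μ = MatrixDP.matrixGaussian 0 S₁ S₂ ∧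
              MatrixDP.IsDP Adj ε δ (MatrixDP.additiveMechanism f μ)}
            (MatrixDP.iidGaussian m n ((s : ℝ) / B))))) ∧
      -- all queries of sensitivity `s`
      ((∃ X X' : 𝕏, Adj X X' ∧ X ≠ X') → ∀ s : ℝ≥0,
        (∀ (S₁ U₁ : Matrix (Fin m) (Fin m) ℝ) (S₂ U₂ : Matrix (Fin n) (Fin n) ℝ),
          S₁.PosDef → S₂.PosDef → U₁ * U₁ᵀ = S₁ → U₂ * U₂ᵀ = S₂ →
          ((∀ f : 𝕏 → Matrix (Fin m) (Fin n) ℝ, MatrixDP.l2Sensitivity Adj f = (s : ℝ≥0∞) →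
              MatrixDP.IsDP Adj ε δ
                (MatrixDP.additiveMechanism f (MatrixDP.matrixGaussian 0 S₁ S₂))) ↔
            MatrixDP.minSingularValue U₁ * MatrixDP.minSingularValue U₂ ≥ (s : ℝ) / B)) ∧
        (0 < s → MatrixDP.IsOptimalNoise
          {μ | ∃ (S₁ : Matrix (Fin m) (Fin m) ℝ) (S₂ : Matrix (Fin n) (Fin n) ℝ),
            S₁.PosDef ∧ S₂.PosDef ∧ μ = MatrixDP.matrixGaussian 0 S₁ S₂ ∧
            ∀ f : 𝕏 → Matrix (Fin m) (Fin n) ℝ, MatrixDP.l2Sensitivity Adj f = (s : ℝ≥0∞) →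
              MatrixDP.IsDP Adj ε δ (MatrixDP.additiveMechanism f μ)}
          (MatrixDP.iidGaussian m n ((s : ℝ) / B)))) := by
  have hδ := hδ₀.le
  refine ⟨MatrixDP.existsUnique_privacyCurve_eq hε hδ₀ hδ₁, fun B hB hBδ => ⟨fun f s hf => ?_,
    fun ⟨X, X', hadj, hne⟩ s => ?_⟩⟩
  · have hsuff : ∀ (S₁ U₁ : Matrix (Fin m) (Fin m) ℝ) (S₂ U₂ : Matrix (Fin n) (Fin n) ℝ),
        S₁.PosDef → S₂.PosDef → U₁ * U₁ᵀ = S₁ → U₂ * U₂ᵀ = S₂ →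
        (s : ℝ) / B ≤ MatrixDP.minSingularValue U₁ * MatrixDP.minSingularValue U₂ →
        MatrixDP.IsDP Adj ε δ
          (MatrixDP.additiveMechanism f (MatrixDP.matrixGaussian 0 S₁ S₂)) := by
      intro S₁ U₁ S₂ U₂ hS₁ hS₂ hU₁ hU₂ hle
      have h₁ := MatrixDP.det_ne_zero_of_mul_transpose_posDef hS₁ hU₁
      have h₂ := MatrixDP.det_ne_zero_of_mul_transpose_posDef hS₂ hU₂
      rw [← hU₁, ← hU₂, MatrixDP.matrixGaussian_eq_gaussianOfFactors h₁ h₂]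
      exact MatrixDP.isDP_of_le_minSingularValue hm hn hε hδ hB hBδ h₁ h₂ hf hle
    refine ⟨hsuff, ?_, fun hdense => ?_⟩
    · exact MatrixDP.isDP_iidGaussian hm hn hε hδ hB hBδ hf
    · have hiff : ∀ (S₁ U₁ : Matrix (Fin m) (Fin m) ℝ) (S₂ U₂ : Matrix (Fin n) (Fin n) ℝ),
          S₁.PosDef → S₂.PosDef → U₁ * U₁ᵀ = S₁ → U₂ * U₂ᵀ = S₂ →
          (MatrixDP.IsDP Adj ε δ
              (MatrixDP.additiveMechanism f (MatrixDP.matrixGaussian 0 S₁ S₂)) ↔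
            MatrixDP.minSingularValue U₁ * MatrixDP.minSingularValue U₂ ≥ (s : ℝ) / B) := by
        intro S₁ U₁ S₂ U₂ hS₁ hS₂ hU₁ hU₂
        refine ⟨fun hDP => ?_, hsuff S₁ U₁ S₂ U₂ hS₁ hS₂ hU₁ hU₂⟩
        have h₁ := MatrixDP.det_ne_zero_of_mul_transpose_posDef hS₁ hU₁
        have h₂ := MatrixDP.det_ne_zero_of_mul_transpose_posDef hS₂ hU₂
        rw [← hU₁, ← hU₂, MatrixDP.matrixGaussian_eq_gaussianOfFactors h₁ h₂] at hDP
        exact MatrixDP.le_minSingularValue_of_isDP_of_dense hm hn hε hδ hB hBδ h₁ h₂ hdense hDP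
      exact ⟨hiff, fun hs => MatrixDP.isOptimalNoise_iidGaussian hm hn
        (div_pos (NNReal.coe_pos.2 hs) hB)
        (fun μ => MatrixDP.IsDP Adj ε δ (MatrixDP.additiveMechanism f μ)) hiff⟩
  · have hiff : ∀ (S₁ U₁ : Matrix (Fin m) (Fin m) ℝ) (S₂ U₂ : Matrix (Fin n) (Fin n) ℝ),
        S₁.PosDef → S₂.PosDef → U₁ * U₁ᵀ = S₁ → U₂ * U₂ᵀ = S₂ →
        ((∀ f : 𝕏 → Matrix (Fin m) (Fin n) ℝ, MatrixDP.l2Sensitivity Adj f = (s : ℝ≥0∞) →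
            MatrixDP.IsDP Adj ε δ
              (MatrixDP.additiveMechanism f (MatrixDP.matrixGaussian 0 S₁ S₂))) ↔
          MatrixDP.minSingularValue U₁ * MatrixDP.minSingularValue U₂ ≥ (s : ℝ) / B) := by
      intro S₁ U₁ S₂ U₂ hS₁ hS₂ hU₁ hU₂
      have h₁ := MatrixDP.det_ne_zero_of_mul_transpose_posDef hS₁ hU₁
      have h₂ := MatrixDP.det_ne_zero_of_mul_transpose_posDef hS₂ hU₂
      rw [← hU₁, ← hU₂, MatrixDP.matrixGaussian_eq_gaussianOfFactors h₁ h₂]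
      exact ⟨MatrixDP.le_minSingularValue_of_forall_isDP hm hn hε hδ hB hBδ h₁ h₂ hadj hne,
        fun hle f hf => MatrixDP.isDP_of_le_minSingularValue hm hn hε hδ hB hBδ h₁ h₂ hf hle⟩
    exact ⟨hiff, fun hs => MatrixDP.isOptimalNoise_iidGaussian hm hn
      (div_pos (NNReal.coe_pos.2 hs) hB)
      (fun μ => ∀ f : 𝕏 → Matrix (Fin m) (Fin n) ℝ, MatrixDP.l2Sensitivity Adj f = (s : ℝ≥0∞) →
        MatrixDP.IsDP Adj ε δ (MatrixDP.additiveMechanism f μ)) hiff⟩
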